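/- Let $n\ge 1$, $W=S_n$ with product $(uv)(k)=u(v(k))$, simple transpositions $s_i=(i,i+1)$, length $\ell(w)$ = number of inversions, and longest element $w_0(k)=n+1-k$. For $w\in W$ and simple $s_i$, $ws_i>w$ means $\ell(ws_i)>\ell(w)$, and $ws_i<w$ means $\ell(ws_i)<\ell(w)$. Let $t$, $\boldsymbol x=(x_1,\dots,x_n)$, $\boldsymbol y=(y_1,\dots,y_n)$ be independent variables and $\boldsymbol y_{w_0}=(y_n,\dots,y_1)$. Write $\boldsymbol x^{\alpha_i}=x_i/x_{i+1}$, let $s_i$ act on functions of $(\boldsymbol x;\boldsymbol y)$ by exchanging $x_i$ and $x_{i+1}$ (fixing $t$ and $\boldsymbol y$), and put, for $1\le i\le n-1$, $$T_i^\vee=\frac{1-t^{-1}}{\boldsymbol x^{\alpha_i}-1}+\frac{-t^{-1}+\boldsymbol x^{-\alpha_i}}{\boldsymbol x^{-\alpha_i}-1}\,s_i .$$ The lifted double dual motivic Chern classes are the elements $\mathrm{MC}^\vee(X(w)^\circ)$ and $\mathrm{MC}^\vee(Y(w)^\circ)$ $(w\in W)$ of $\mathbb C[t^{\pm1},\boldsymbol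 x^{\pm1},\boldsymbol y^{\pm1}]$ determined by $$\mathrm{MC}^\vee(X(1)^\circ)=\prod_{1\le i<j\le n}\Bigl(1-\frac{x_i}{y_j}\Bigr),\qquad \mathrm{MC}^\vee(X(ws_i)^\circ)=T_i^\vee\,\mathrm{MC}^\vee(X(w)^\circ)\ \text{ if } ws_i>w,$$ $$\mathrm{MC}^\vee(Y(w_0)^\circ)=\prod_{i,j\ge 1,\ i+j\le n}\Bigl(1-\frac{x_i}{y_j}\Bigr),\qquad \mathrm{MC}^\vee(Y(ws_i)^\circ)=T_i^\vee\,\mathrm{MC}^\vee(Y(w)^\circ)\ \text{ if } ws_i<w.$$ *Lattice model.* Take an $n\times n$ grid with rows $1,\dots,n$ from top to bottom and columns $1,\dots,n$ from right to left. Each horizontal edge carries either no color ($+$) or one color from $\{1,\dots,n\}$; each vertical edge carries a subset of $\{1,\dots,n\}$. For $\sigma,w\in W$ the boundary conditions are: the top edge of column $n+1-i$ carries $\{\sigma(n+1-i)\}$ for each $i$, the right edge of row $i$ carries $w(i)$, and all left and bottom boundary edges are uncolored. For a set of colors $\Sigma$ and a color $c$ write $\Sigma_{>c}=|\{e\in\Sigma: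 e>c\}|$, $\Sigma_{<c}=|\{e\in\Sigma: e<c\}|$, $\Sigma_c=|\Sigma\cap\{c\}|$, and for $c<d$ write $\Sigma_{(c,d)}=|\{e\in\Sigma: c<e<d\}|$. The weight of a vertex in row $i$ and column $j$ with labels (left, top, right, bottom) is, with $x=x_i$, $y=y_j$ and colors $c<d$ in the last two cases: 1. $(+,\Sigma,+,\Sigma)$: $(-t)^{|\Sigma|}$; 2. $(c,\Sigma,c,\Sigma)$: $t^{\Sigma_{>c}}\bigl(t^{\Sigma_c}-x/y\bigr)$; 3. $(+,\Sigma,c,\Sigma\setminus\{c\})$ with $c\in\Sigma$: $(-t)^{\Sigma_{<c}}\,t^{\Sigma_{>c}}$; 4. $(c,\Sigma,+,\Sigma\cup\{c\})$ with $c\notin\Sigma$: $(t-1)\frac xy(-t)^{\Sigma_{>c}}$; 5. $(c,\Sigma,d,(\Sigma\cup\{c\})\setminus\{d\})$ with $c\notin\Sigma\ni d$: $(t-1)\frac xy(-t)^{\Sigma_{(c,d)}}\,t^{\Sigma_{>d}}$; 6. $(d,\Sigma,c,(\Sigma\cup\{d\})\setminus\{c\})$ with $d\notin\Sigma\ni c$: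 $(t-1)(-1)^{\Sigma_{(c,d)}}\,t^{\Sigma_{>d}}$. No other vertex configuration is admissible. $Z^\square_{\sigma,w}(\boldsymbol x;\boldsymbol y)$ is the sum, over all decorations of the edges with these boundary conditions and with every vertex admissible, of the product of the vertex weights. **Theorem.** The two families above exist and are uniquely determined by the stated properties, and for every $w\in S_n$, $$\mathrm{MC}^\vee(X(w)^\circ)=(-t)^{-\ell(w)}\,Z^\square_{1,\,w_0w}(\boldsymbol x;\boldsymbol y_{w_0}),\qquad \mathrm{MC}^\vee(Y(w)^\circ)=(-t)^{-\ell(w^{-1}w_0)}\,Z^\square_{1,\,w}(\boldsymbol x;\boldsymbol y).$$ -/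

import Mathlib

namespace MotivicLattice

/-! ## Permutations

A permutation of `{1, …, n}` is an element of `Equiv.Perm (Fin n)` (indices shifted by one), and
`w * s` is the composite `w ∘ s`. -/

/-- The length `ℓ(w)`: the number of inversions of `w`. -/
def len {n : ℕ} (w : Equiv.Perm (Fin n)) : ℕ :=
  (Finset.univ.filter (fun p : Fin n × Fin n => p.1 < p.2 ∧ w p.2 < w p.1)).card

/-- The simple transposition exchanging the positions `i` and `i + 1` (counted from `0`). -/
def simpleRefl {n : ℕ} (i : ℕ) (hi : i + 1 < n) : Equiv.Perm (Fin n) :=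
  Equiv.swap ⟨i, Nat.lt_of_succ_lt hi⟩ ⟨i + 1, hi⟩

/-- The longest permutation `w₀ : i ↦ n + 1 - i`. -/
def longest (n : ℕ) : Equiv.Perm (Fin n) := Fin.revPerm

/-! ## The lattice model

The grid has `n` rows, numbered from top to bottom, and `N` columns, numbered from right to left.
The colors are the elements of `Fin n`. A horizontal edge carries a color or nothing (`none`), a
vertical edge carries a set of colors. -/

/-- The Boltzmann weight of a vertex with row parameter `x` and column parameter `y`, whose
left, top, right and bottom edges carry the given labels. Configurations that are not
admissible have weight `0`. -/
def weight {K : Type*} [Field K] {n : ℕ} (t x y : K)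
    (left : Option (Fin n)) (top : Finset (Fin n))
    (right : Option (Fin n)) (bottom : Finset (Fin n)) : K :=
  match left, right with
  | none, none =>
      if bottom = top then (-t) ^ top.card else 0
  | none, some c =>
      if c ∈ top ∧ bottom = top.erase c then
        (-t) ^ (top.filter (fun e => e < c)).card * t ^ (top.filter (fun e => c < e)).card
      else 0
  | some c, none =>
      if c ∉ top ∧ bottom = insert c top then
        (t - 1) * (x / y) * (-t) ^ (top.filter (fun e => c < e)).card
      else 0
  | some c, some d =>
      if c = d then
        if bottom = top then
          t ^ (top.filter (fun e => c < e)).card * (t ^ (top.filter (fun e => e = c)).card - x / y)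
        else 0
      else if c ∉ top ∧ d ∈ top ∧ bottom = insert c (top.erase d) then
        if c < d then
          (t - 1) * (x / y) * (-t) ^ (top.filter (fun e => c < e ∧ e < d)).card *
            t ^ (top.filter (fun e => d < e)).card
        else
          (t - 1) * (-1) ^ (top.filter (fun e => d < e ∧ e < c)).card *
            t ^ (top.filter (fun e => c < e)).card
      else 0

/-- A decoration of all edges of the grid with `n` rows and `N` columns.

`horiz i k` is the horizontal edge in row `i` with exactly `k` columns to its right: `k = 0` is the
right boundary, `k = N` the left boundary, and the vertex in the column `j` (counted from `0` at
the right) has right edge `k = j` and left edge `k = j + 1`.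

`vert k j` is the vertical edge in column `j` with exactly `k` rows above it: `k = 0` is the top
boundary, `k = n` the bottom boundary. -/
@[ext]
structure Decoration (n N : ℕ) where
  horiz : Fin n → Fin (N + 1) → Option (Fin n)
  vert : Fin (n + 1) → Fin N → Finset (Fin n)

/-- Decorations as pairs of functions. -/
def Decoration.equivProd (n N : ℕ) : Decoration n N ≃
    (Fin n → Fin (N + 1) → Option (Fin n)) × (Fin (n + 1) → Fin N → Finset (Fin n)) where
  toFun s := (s.horiz, s.vert)
  invFun p := ⟨p.1, p.2⟩
  left_inv _ := rfl
  right_inv _ := rfl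

instance (n N : ℕ) : Fintype (Decoration n N) :=
  Fintype.ofEquiv _ (Decoration.equivProd n N).symm

/-- The boundary conditions attached to permutations `σ`, `w` and a partition
`lam = (lam 0 ≥ lam 1 ≥ …)`: along the top, column number `λ_i` carries the color `σ (n + 1 - i)`;
along the right, row `i` carries the color `w i`; left and bottom edges are uncolored. -/
def Decoration.HasBoundary {n N : ℕ} (s : Decoration n N) (σ w : Equiv.Perm (Fin n))
    (lam : Fin n → ℕ) : Prop :=
  (∀ j : Fin N, s.vert 0 j =
      (Finset.univ.filter (fun i : Fin n => lam i = (j : ℕ) + 1)).image (fun i => σ i.rev)) ∧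
  (∀ i : Fin n, s.horiz i 0 = some (w i)) ∧
  (∀ i : Fin n, s.horiz i (Fin.last N) = none) ∧
  (∀ j : Fin N, s.vert (Fin.last n) j = ∅)

instance {n N : ℕ} (s : Decoration n N) (σ w : Equiv.Perm (Fin n)) (lam : Fin n → ℕ) :
    Decidable (s.HasBoundary σ w lam) := by
  unfold Decoration.HasBoundary
  infer_instance

/-- The Boltzmann weight of a decorated grid: the product of the weights of its vertices. -/
def Decoration.boltzmann {K : Type*} [Field K] {n N : ℕ} (t : K) (x : Fin n → K) (y : Fin N → K)
    (s : Decoration n N) : K :=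
  ∏ i : Fin n, ∏ j : Fin N,
    weight t (x i) (y j) (s.horiz i j.succ) (s.vert i.castSucc j)
      (s.horiz i j.castSucc) (s.vert i.succ j)

/-- The partition function `Z^λ_{σ,w}(x; y)`. -/
def partitionFunction {K : Type*} [Field K] {n N : ℕ} (t : K) (lam : Fin n → ℕ)
    (σ w : Equiv.Perm (Fin n)) (x : Fin n → K) (y : Fin N → K) : K :=
  ∑ s ∈ Finset.univ.filter (fun s : Decoration n N => s.HasBoundary σ w lam), s.boltzmann t x y

/-- The staircase partition `□ = (n, n - 1, …, 1)`. -/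
def staircase (n : ℕ) : Fin n → ℕ := fun i => n - i

/-- The partition function `Z^□_{σ,w}(x; y)` of the square grid. -/
def squareZ {K : Type*} [Field K] {n : ℕ} (t : K) (σ w : Equiv.Perm (Fin n))
    (x y : Fin n → K) : K :=
  partitionFunction t (staircase n) σ w x y

/-! ## Laurent polynomials in `t`, `x₁, …, xₙ`, `y₁, …, yₙ` -/

/-- The names of the `2n + 1` variables. -/
inductive Var (n : ℕ) : Type
  | t : Var n
  | x (i : Fin n) : Var n
  | y (j : Fin n) : Var n

/-- The field `ℂ(t, x₁, …, xₙ, y₁, …, yₙ)` of rational functions. -/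
abbrev RatFun (n : ℕ) : Type := FractionRing (MvPolynomial (Var n) ℂ)

noncomputable section

/-- A variable as a rational function. -/
def var {n : ℕ} (v : Var n) : RatFun n :=
  algebraMap (MvPolynomial (Var n) ℂ) (RatFun n) (MvPolynomial.X v)

/-- The variable `t`. -/
def tVar (n : ℕ) : RatFun n := var Var.t

/-- The variables `x₁, …, xₙ`. -/
def xVar (n : ℕ) : Fin n → RatFun n := fun i => var (Var.x i)

/-- The variables `y₁, …, yₙ`. -/
def yVar (n : ℕ) : Fin n → RatFun n := fun j => var (Var.y j)

/-- The ring `ℂ[t^{±1}, x₁^{±1}, …, xₙ^{±1}, y₁^{±1}, …, yₙ^{±1}]` of Laurent polynomials, as a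
subalgebra of the field of rational functions. -/
def laurent (n : ℕ) : Subalgebra ℂ (RatFun n) :=
  Algebra.adjoin ℂ {f | ∃ v : Var n, f = var v ∨ f = (var v)⁻¹}

/-- A permutation `e` of the indices permutes the variables by `x_k ↦ x_{e k}`, fixing `t` and the
`y_j`. -/
def Var.permX {n : ℕ} (e : Equiv.Perm (Fin n)) : Equiv.Perm (Var n) where
  toFun
    | .t => .t
    | .x i => .x (e i)
    | .y j => .y j
  invFun
    | .t => .t
    | .x i => .x (e.symm i)
    | .y j => .y j
  left_inv v := by cases v <;> simp
  right_inv v := by cases v <;> simp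

/-- The action of permutations on rational functions through the variables `x`:
`(e · f)(x; y) = f(x_{e 1}, …, x_{e n}; y)`. -/
def actX {n : ℕ} (e : Equiv.Perm (Fin n)) : RatFun n ≃+* RatFun n :=
  IsFractionRing.ringEquivOfRingEquiv
    (MvPolynomial.renameEquiv ℂ (Var.permX e)).toRingEquiv

/-! ## Lifted double dual motivic Chern classes -/

/-- The operator `T_i^∨`, where `X = x^{α_i} = x_i / x_{i+1}`:
`T_i^∨ f = (1 - t⁻¹)/(X - 1) · f + (-t⁻¹ + X⁻¹)/(X⁻¹ - 1) · (s_i f)`. -/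
def dualT {n : ℕ} (i : ℕ) (hi : i + 1 < n) (f : RatFun n) : RatFun n :=
  let X : RatFun n := xVar n ⟨i, Nat.lt_of_succ_lt hi⟩ / xVar n ⟨i + 1, hi⟩
  (1 - (tVar n)⁻¹) / (X - 1) * f +
    (-(tVar n)⁻¹ + X⁻¹) / (X⁻¹ - 1) * actX (simpleRefl i hi) f

/-- The defining properties of the family `w ↦ MC^∨(X(w)°)` of lifted double dual motivic Chern
classes of the Schubert cells. (For a simple transposition, `w < w s_i` in the Bruhat order means
`ℓ(w) < ℓ(w s_i)`.) -/
structure IsDualMCX (n : ℕ) (F : Equiv.Perm (Fin n) → RatFun n) : Prop where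
  mem_laurent : ∀ w, F w ∈ laurent n
  base : F 1 = ∏ i : Fin n, ∏ j ∈ Finset.univ.filter (fun j : Fin n => i < j),
    (1 - xVar n i / yVar n j)
  step : ∀ (w : Equiv.Perm (Fin n)) (i : ℕ) (hi : i + 1 < n),
    len w < len (w * simpleRefl i hi) → F (w * simpleRefl i hi) = dualT i hi (F w)

/-- The defining properties of the family `w ↦ MC^∨(Y(w)°)` of lifted double dual motivic Chern
classes of the opposite Schubert cells. The condition `i + j + 2 ≤ n` is `i + j ≤ n` for
indices counted from `1`. -/
structure IsDualMCY (n : ℕ) (G : Equiv.Perm (Fin n) → RatFun n) : Prop where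
  mem_laurent : ∀ w, G w ∈ laurent n
  base : G (longest n) =
    ∏ i : Fin n, ∏ j ∈ Finset.univ.filter (fun j : Fin n => (i : ℕ) + (j : ℕ) + 2 ≤ n),
      (1 - xVar n i / yVar n j)
  step : ∀ (w : Equiv.Perm (Fin n)) (i : ℕ) (hi : i + 1 < n),
    len (w * simpleRefl i hi) < len w → G (w * simpleRefl i hi) = dualT i hi (G w)

/-- The lifted double dual motivic Chern classes `MC^∨(X(w)°)`: the family determined by
`IsDualMCX`. -/
def dualMCX (n : ℕ) : Equiv.Perm (Fin n) → RatFun n := Classical.epsilon (IsDualMCX n)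

/-- The lifted double dual motivic Chern classes `MC^∨(Y(w)°)`: the family determined by
`IsDualMCY`. -/
def dualMCY (n : ℕ) : Equiv.Perm (Fin n) → RatFun n := Classical.epsilon (IsDualMCY n)

end

end MotivicLattice

set_option linter.unusedSimpArgs false
set_option linter.unusedVariables false

/-! The right-hand sides satisfy the defining properties of the two families, and these properties
determine each family. Both classes come from one recursion for the partition function: if `w` has a
descent at `i`, then `Z_{ws_i} = -t · T_i^∨ Z_w`. The power of `-t` in front absorbs the factor `-t`
of each step. For `Y` the index is `w` itself; for `X` it is `w₀w`, because left multiplication by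
`w₀` exchanges ascents and descents. Both recursions start at `Z_{w₀}`.

The recursion is a Yang–Baxter argument. An `R`-matrix, independent of the column parameter,
intertwines two vertices stacked in a column with the same two vertices after exchange of their row
parameters (`columnWeight_yangBaxter`). It passes through two whole adjacent rows
(`rMatrix_mul_twoRowWeight`). The left boundary is uncolored, so `R` is a scalar there; on the right
it mixes the two orders of the boundary colors. The resulting three-term relation
(`rowMatrix_exchange`, `squareZ_exchange`) is the formula for `T_i^∨`, once the exchange of row
parameters is read as the action of `s_i`.

Vertical edges carry arbitrary sets, so the Yang–Baxter equation is not a finite check as it stands.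
Each weight, however, is a product over the colors on the top edge times a factor that sees only the
horizontal colors (`weight_eq`). In a column of two vertices these products are common to all terms
(`columnWeight_eq`), and what remains involves at most four colors and their multiplicities
(`coreYangBaxter`).

At `w₀` the model is frozen: a single state contributes, and its weight is the product prescribed as
initial value (`squareZ_longest`). Uniqueness of the families is induction on length, since every `w
≠ 1` has a descent and every `w ≠ w₀` an ascent. -/

namespace MotivicLattice

/-! ### Factorization of the vertex weights and of columns of two vertices. -/

section YangBaxter

variable {K : Type*} [Field K] {n : ℕ}

/-- The multiplicity of the color `e` on a horizontal edge. -/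
def hmult (p : Option (Fin n)) (e : Fin n) : ℕ := if p = some e then 1 else 0

/-- The multiplicity of the color `e` on a vertical edge. -/
def vmult (S : Finset (Fin n)) (e : Fin n) : ℕ := if e ∈ S then 1 else 0

/-- Conservation of colors at a vertex. -/
def Conserved (p : Option (Fin n)) (S : Finset (Fin n)) (c : Option (Fin n))
    (B : Finset (Fin n)) : Prop :=
  ∀ e, vmult B e + hmult c e = vmult S e + hmult p e

/-- The factor of a vertex with left edge `p` due to a color `e` on its top edge. -/
def leftFactor (t : K) (p : Option (Fin n)) (e : Fin n) : K :=
  match p with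
  | none => -t
  | some c => if c < e then -t else 1

/-- The factor of a vertex with right edge `c` due to a color `e` on its top edge. -/
def rightFactor (c : Option (Fin n)) (e : Fin n) : K :=
  match c with
  | none => 1
  | some c => if c < e then -1 else 1

/-- The part of the weight of an admissible vertex that is not a product over the top edge; `k` is
the multiplicity of the right color on the top edge. -/
def coreWeight (t z : K) (p c : Option (Fin n)) (k : ℕ) : K :=
  match p, c with
  | none, none => 1
  | none, some _ => -t⁻¹
  | some _, none => (t - 1) * z
  | some c, some d =>
      if c = d then t ^ k - z else if c < d then (t - 1) * z * (-t⁻¹) else t - 1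

/-- The multiplicity of an optional color in a set. -/
def omult (S : Finset (Fin n)) (c : Option (Fin n)) : ℕ := c.elim 0 (vmult S)

theorem prod_leftFactor_none (t : K) (S : Finset (Fin n)) :
    ∏ e ∈ S, leftFactor t none e = (-t) ^ S.card := by
  simp [leftFactor]

theorem prod_leftFactor_some (t : K) (S : Finset (Fin n)) (c : Fin n) :
    ∏ e ∈ S, leftFactor t (some c) e = (-t) ^ (S.filter (fun e => c < e)).card := by
  simp [leftFactor, Finset.prod_ite]

theorem prod_rightFactor_none (S : Finset (Fin n)) :
    ∏ e ∈ S, (rightFactor none e : K) = 1 := by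
  simp [rightFactor]

theorem prod_rightFactor_some (S : Finset (Fin n)) (c : Fin n) :
    ∏ e ∈ S, (rightFactor (some c) e : K) = (-1) ^ (S.filter (fun e => c < e)).card := by
  simp [rightFactor, Finset.prod_ite]

theorem card_filter_between (S : Finset (Fin n)) {c d : Fin n} (hd : d ∈ S) (h : c < d) :
    (S.filter (fun e => c < e)).card =
      (S.filter (fun e => c < e ∧ e < d)).card + 1 + (S.filter (fun e => d < e)).card := by
  have h1 : S.filter (fun e => c < e) =
      (S.filter (fun e => c < e ∧ e < d) ∪ {d}) ∪ S.filter (fun e => d < e) := by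
    ext e; simp only [Finset.mem_filter, Finset.mem_union, Finset.mem_singleton]; grind
  rw [h1, Finset.card_union_of_disjoint, Finset.card_union_of_disjoint, Finset.card_singleton]
  · rw [Finset.disjoint_left]; intro e; simp only [Finset.mem_filter, Finset.mem_singleton]; grind
  · rw [Finset.disjoint_left]; intro e
    simp only [Finset.mem_filter, Finset.mem_union, Finset.mem_singleton]; grind

theorem card_filter_between' (S : Finset (Fin n)) {c d : Fin n} (hd : d ∉ S) (h : c < d) :
    (S.filter (fun e => c < e)).card =
      (S.filter (fun e => c < e ∧ e < d)).card + (S.filter (fun e => d < e)).card := by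
  have h1 : S.filter (fun e => c < e) =
      (S.filter (fun e => c < e ∧ e < d)) ∪ S.filter (fun e => d < e) := by
    ext e; simp only [Finset.mem_filter, Finset.mem_union]; grind
  rw [h1, Finset.card_union_of_disjoint]
  rw [Finset.disjoint_left]; intro e; simp only [Finset.mem_filter]; grind

theorem card_eq_filter (S : Finset (Fin n)) {c : Fin n} (hc : c ∈ S) :
    S.card = (S.filter (fun e => e < c)).card + 1 + (S.filter (fun e => c < e)).card := by
  have h1 : S = (S.filter (fun e => e < c) ∪ {c}) ∪ S.filter (fun e => c < e) := by
    ext e; simp only [Finset.mem_filter, Finset.mem_union, Finset.mem_singleton]; grind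
  conv_lhs => rw [h1]
  rw [Finset.card_union_of_disjoint, Finset.card_union_of_disjoint, Finset.card_singleton]
  · rw [Finset.disjoint_left]; intro e; simp only [Finset.mem_filter, Finset.mem_singleton]; grind
  · rw [Finset.disjoint_left]; intro e
    simp only [Finset.mem_filter, Finset.mem_union, Finset.mem_singleton]; grind

-- Admissibility is exactly conservation of colors. The products over the top edge also count the
-- outgoing color when it is there; the factor `-t⁻¹` in `coreWeight` cancels this surplus `-t` when
-- the left edge is uncolored or carries a smaller color. Signs from colors above both horizontal
-- ones cancel in pairs, turning powers of `-t` into powers of `t`.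
open Classical in
theorem weight_eq {t : K} (ht : t ≠ 0) (x y : K) (p : Option (Fin n)) (S : Finset (Fin n))
    (c : Option (Fin n)) (B : Finset (Fin n)) :
    weight t x y p S c B = if Conserved p S c B then
      coreWeight t (x / y) p c (omult S c) * (∏ e ∈ S, leftFactor t p e) *
        ∏ e ∈ S, rightFactor c e else 0 := by
  rcases p with _ | p <;> rcases c with _ | c
  · have h : Conserved none S none B ↔ B = S := by
      simp only [Conserved, vmult, hmult, Finset.ext_iff]
      refine forall_congr' fun e => ?_
      grind
    simp only [weight, h, coreWeight, prod_leftFactor_none, prod_rightFactor_none, one_mul, mul_one]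
  · have h : Conserved none S (some c) B ↔ c ∈ S ∧ B = S.erase c := by
      simp only [Conserved, vmult, hmult, Finset.ext_iff, Finset.mem_erase]
      constructor
      · intro h
        have := h c
        refine ⟨by grind, fun e => ?_⟩
        have := h e
        grind
      · rintro ⟨h, h'⟩ e
        have := h' e
        grind
    simp only [weight, h, coreWeight, prod_leftFactor_none, prod_rightFactor_some]
    refine if_ctx_congr Iff.rfl (fun hc => ?_) fun _ => rfl
    rw [card_eq_filter S hc.1, pow_add, pow_add, pow_one,
      neg_pow t (Finset.card (S.filter (fun e => c < e)))]
    have : ((-1 : K) ^ (S.filter (fun e => c < e)).card) ^ 2 = 1 := by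
      rw [← pow_mul, mul_comm, pow_mul]; simp
    have ht' : t⁻¹ * t = 1 := inv_mul_cancel₀ ht
    generalize (-t) ^ (S.filter (fun e => e < c)).card = u at *
    generalize (-1 : K) ^ (S.filter (fun e => c < e)).card = v at *
    generalize t ^ (S.filter (fun e => c < e)).card = w at *
    linear_combination (-u * w * v ^ 2) * ht' - u * w * this
  · have h : Conserved (some p) S none B ↔ p ∉ S ∧ B = insert p S := by
      simp only [Conserved, vmult, hmult, Finset.ext_iff, Finset.mem_insert]
      constructor
      · intro h
        have := h p
        refine ⟨by grind, fun e => ?_⟩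
        have := h e
        grind
      · rintro ⟨h, h'⟩ e
        have := h' e
        grind
    simp only [weight, h, coreWeight, prod_leftFactor_some, prod_rightFactor_none, mul_one]
  · by_cases hpc : p = c
    · subst hpc
      have h : Conserved (some p) S (some p) B ↔ B = S := by
        simp only [Conserved, vmult, hmult, Finset.ext_iff]
        refine forall_congr' fun e => ?_
        grind
      simp only [weight, h, coreWeight, prod_leftFactor_some, prod_rightFactor_some, if_true]
      refine if_ctx_congr Iff.rfl (fun _ => ?_) fun _ => rfl
      have h1 : (S.filter (fun e => e = p)).card = omult S (some p) := by
        simp only [omult, vmult, Option.elim]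
        split_ifs with h
        · rw [Finset.filter_eq' , if_pos h, Finset.card_singleton]
        · rw [Finset.filter_eq' , if_neg h, Finset.card_empty]
      rw [h1, mul_assoc, ← mul_pow, mul_comm]
      simp
    · have h : Conserved (some p) S (some c) B ↔ p ∉ S ∧ c ∈ S ∧ B = insert p (S.erase c) := by
        simp only [Conserved, vmult, hmult, Finset.ext_iff, Finset.mem_insert, Finset.mem_erase]
        constructor
        · intro h
          have := h p
          have := h c
          refine ⟨by grind, by grind, fun e => ?_⟩
          have := h e
          grind
        · rintro ⟨h, h1, h'⟩ e
          have := h' e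
          grind
      simp only [weight, h, coreWeight, prod_leftFactor_some, prod_rightFactor_some, if_neg hpc]
      refine if_ctx_congr Iff.rfl (fun hS => ?_) fun _ => rfl
      rcases lt_or_gt_of_ne hpc with hlt | hlt
      · rw [if_pos hlt, if_pos hlt, card_filter_between S hS.2.1 hlt, pow_add, pow_add]
        rw [show (-t) ^ (S.filter (fun e => c < e)).card = (-1) ^ (S.filter (fun e => c < e)).card
          * t ^ (S.filter (fun e => c < e)).card from neg_pow _ _]
        have : ((-1 : K) ^ (S.filter (fun e => c < e)).card) ^ 2 = 1 := by
          rw [← pow_mul, mul_comm, pow_mul]; simp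
        rw [pow_one]
        generalize (-t) ^ (S.filter (fun e => p < e ∧ e < c)).card = u at *
        generalize (-1 : K) ^ (S.filter (fun e => c < e)).card = v at *
        have ht' : t⁻¹ * t = 1 := inv_mul_cancel₀ ht
        linear_combination (-(t - 1) * (x / y) * u * t ^ (S.filter (fun e => c < e)).card) * this
          - ((t - 1) * (x / y) * u * t ^ (S.filter (fun e => c < e)).card) * v ^ 2 * ht'
      · rw [if_neg hlt.not_gt, if_neg hlt.not_gt, card_filter_between' S hS.1 hlt, pow_add]
        rw [show (-t) ^ (S.filter (fun e => p < e)).card = (-1) ^ (S.filter (fun e => p < e)).card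
          * t ^ (S.filter (fun e => p < e)).card from neg_pow _ _]
        have : ((-1 : K) ^ (S.filter (fun e => p < e)).card) ^ 2 = 1 := by
          rw [← pow_mul, mul_comm, pow_mul]; simp
        generalize (-1 : K) ^ (S.filter (fun e => p < e)).card = v at *
        linear_combination (-(t - 1) * (-1) ^ (S.filter (fun e => c < e ∧ e < p)).card *
          t ^ (S.filter (fun e => p < e)).card) * this

theorem prod_pow_vmult (S : Finset (Fin n)) (g : Fin n → K) :
    ∏ e, g e ^ vmult S e = ∏ e ∈ S, g e := by
  simp only [vmult, pow_ite, pow_one, pow_zero]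
  rw [Finset.prod_ite_mem, Finset.univ_inter]

theorem prod_pow_hmult (c : Option (Fin n)) (g : Fin n → K) :
    ∏ e, g e ^ hmult c e = c.elim 1 g := by
  rcases c with _ | c
  · simp [hmult]
  · simp [hmult, pow_ite]

/-- This moves a product over the edge between two vertices up to the top edge, at the cost of one
correction for each horizontal color. -/
theorem Conserved.prod_eq {p c : Option (Fin n)} {S B : Finset (Fin n)} (h : Conserved p S c B)
    (g : Fin n → K) : (∏ e ∈ B, g e) * c.elim 1 g = (∏ e ∈ S, g e) * p.elim 1 g := by
  rw [← prod_pow_vmult B, ← prod_pow_vmult S, ← prod_pow_hmult, ← prod_pow_hmult,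
    ← Finset.prod_mul_distrib, ← Finset.prod_mul_distrib]
  refine Finset.prod_congr rfl fun e _ => ?_
  rw [← pow_add, ← pow_add, h e]

/-- Conservation of colors through two vertices in the same column. -/
def Conserved₂ (p q : Option (Fin n)) (S : Finset (Fin n)) (c d : Option (Fin n))
    (B : Finset (Fin n)) : Prop :=
  ∀ e, vmult B e + hmult c e + hmult d e = vmult S e + hmult p e + hmult q e

theorem Conserved.trans {p q c d : Option (Fin n)} {S m B : Finset (Fin n)}
    (h : Conserved p S c m) (h' : Conserved q m d B) : Conserved₂ p q S c d B := by
  intro e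
  have h1 := h e
  have h2 := h' e
  omega

theorem Conserved₂.second {p q c d : Option (Fin n)} {S m B : Finset (Fin n)}
    (h : Conserved₂ p q S c d B) (h' : Conserved p S c m) : Conserved q m d B := by
  intro e
  have h1 := h e
  have h2 := h' e
  omega

theorem Conserved.unique {p c : Option (Fin n)} {S B B' : Finset (Fin n)}
    (h : Conserved p S c B) (h' : Conserved p S c B') : B = B' := by
  ext e
  have h1 := h e
  have h2 := h' e
  have h3 : vmult B e = vmult B' e := by omega
  simp only [vmult] at h3
  grind

/-- Unless the color passes straight through, the incoming color must be absent from the top and the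
outgoing one present. The default values `0` and `1` make these conditions vacuous for an uncolored
edge. -/
theorem exists_conserved_iff (p c : Option (Fin n)) (S : Finset (Fin n)) :
    (∃ m, Conserved p S c m) ↔
      p = c ∨ p.elim 0 (vmult S) = 0 ∧ c.elim 1 (vmult S) = 1 := by
  constructor
  · rintro ⟨m, h⟩
    by_cases hpc : p = c
    · exact Or.inl hpc
    refine Or.inr ⟨?_, ?_⟩
    · rcases p with _ | p
      · rfl
      · have := h p
        simp only [vmult, hmult, Option.elim] at *
        grind
    · rcases c with _ | c
      · rfl
      · have := h c
        simp only [vmult, hmult, Option.elim] at *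
        grind
  · rintro (rfl | ⟨h1, h2⟩)
    · exact ⟨S, fun e => rfl⟩
    · refine ⟨(S ∪ p.toFinset) \ c.toFinset ∪ (p.toFinset ∩ c.toFinset), fun e => ?_⟩
      rcases p with _ | p <;> rcases c with _ | c <;>
        simp only [vmult, hmult, Option.elim, Option.toFinset_none, Option.toFinset_some,
          Finset.mem_union, Finset.mem_sdiff, Finset.mem_inter, Finset.mem_singleton,
          Finset.notMem_empty] at * <;> grind

/-- The weight of two vertices in the same column, the upper one in a row with parameter `x₁`,
summed over the edge between them. -/
def columnWeight (t x₁ x₂ y : K) (S B : Finset (Fin n)) (l r : Option (Fin n) × Option (Fin n)) :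
    K :=
  ∑ m, weight t x₁ y l.1 S r.1 m * weight t x₂ y l.2 m r.2 B

/-- The part of `columnWeight` that depends on the vertical edges only through the multiplicities of
the colors on the horizontal edges. -/
def columnCore (t z₁ z₂ : K) (v : Fin n → ℕ) (p q c d : Option (Fin n)) : K :=
  if p = c ∨ p.elim 0 v = 0 ∧ c.elim 1 v = 1 then
    coreWeight t z₁ p c (c.elim 0 v) *
      coreWeight t z₂ q d (d.elim 0 fun e => v e + hmult p e - hmult c e) *
      (p.elim 1 (leftFactor t q) * (c.elim 1 (leftFactor t q))⁻¹ *
        (p.elim 1 (rightFactor d) * (c.elim 1 (rightFactor d))⁻¹))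
  else 0

theorem leftFactor_ne_zero {t : K} (ht : t ≠ 0) (p : Option (Fin n)) (e : Fin n) :
    leftFactor t p e ≠ 0 := by
  unfold leftFactor; split <;> [skip; split_ifs] <;> simp [ht]

theorem rightFactor_ne_zero (p : Option (Fin n)) (e : Fin n) :
    (rightFactor p e : K) ≠ 0 := by
  unfold rightFactor; split <;> [skip; split_ifs] <;> simp

theorem elim_ne_zero {g : Fin n → K} (hg : ∀ e, g e ≠ 0) (p : Option (Fin n)) :
    p.elim 1 g ≠ 0 := by
  cases p <;> simp [hg]

open Classical in
theorem columnWeight_eq_zero {t : K} (ht : t ≠ 0) (x₁ x₂ y : K) {S B : Finset (Fin n)}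
    {p q c d : Option (Fin n)} (h : ¬ Conserved₂ p q S c d B) :
    columnWeight t x₁ x₂ y S B (p, q) (c, d) = 0 := by
  refine Finset.sum_eq_zero fun m _ => ?_
  simp only [weight_eq ht]
  split_ifs with h1 h2 <;> try simp
  exact absurd (h1.trans h2) h

/-- Conservation leaves at most one label for the middle edge, so the sum has at most one nonzero
term. The product over `S` on the right is symmetric under `p ↔ q` and under `c ↔ d`, hence common
to all terms of the Yang–Baxter equation. -/
theorem columnWeight_eq {t : K} (ht : t ≠ 0) (x₁ x₂ y : K) {S B : Finset (Fin n)}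
    {p q c d : Option (Fin n)} (h : Conserved₂ p q S c d B) :
    columnWeight t x₁ x₂ y S B (p, q) (c, d) =
      columnCore t (x₁ / y) (x₂ / y) (vmult S) p q c d *
      ((∏ e ∈ S, leftFactor t p e) * (∏ e ∈ S, leftFactor t q e) *
        ((∏ e ∈ S, rightFactor c e) * ∏ e ∈ S, rightFactor d e)) := by
  unfold columnCore
  split_ifs with hadm
  · obtain ⟨m, hm⟩ := (exists_conserved_iff p c S).2 hadm
    unfold columnWeight
    rw [Finset.sum_eq_single m]
    · have hm' := h.second hm
      rw [weight_eq ht, weight_eq ht, if_pos hm, if_pos hm']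
      have h1 := hm.prod_eq (leftFactor t q)
      have h2 := hm.prod_eq (rightFactor (K := K) d)
      rw [← eq_mul_inv_iff_mul_eq₀ (elim_ne_zero (leftFactor_ne_zero ht q) c)] at h1
      rw [← eq_mul_inv_iff_mul_eq₀ (elim_ne_zero (rightFactor_ne_zero d) c)] at h2
      -- Truncated subtraction loses nothing: conservation at the upper vertex bounds `hmult c` by
      -- `vmult S + hmult p`.
      have h3 : omult m d = d.elim 0 fun e => vmult S e + hmult p e - hmult c e := by
        rcases d with _ | d
        · rfl
        · have := hm d
          simp only [omult, Option.elim]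
          omega
      rw [h1, h2, h3]
      unfold omult
      ring
    · intro m' _ hne
      rw [weight_eq ht, if_neg, zero_mul]
      exact fun h' => hne (h'.unique hm)
    · simp
  · rw [zero_mul]
    refine Finset.sum_eq_zero fun m _ => ?_
    rw [weight_eq ht, if_neg, zero_mul]
    exact fun h' => hadm ((exists_conserved_iff p c S).1 ⟨m, h'⟩)

/-! ### The `R`-matrix and the local Yang–Baxter equation, by coincidence pattern of the colors. -/

/-- The diagonal entries of the `R`-matrix. -/
def rDiag (t x₁ x₂ : K) : Option (Fin n) → Option (Fin n) → K
  | none, none => x₂ - t * x₁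
  | none, some _ => (1 - t) * x₁
  | some _, none => (1 - t) * x₂
  | some c, some d =>
      if c = d then x₁ - t * x₂ else if c < d then (1 - t) * x₂ else (1 - t) * x₁

/-- The off-diagonal entries of the `R`-matrix. -/
def rOff (t x₁ x₂ : K) : Option (Fin n) → Option (Fin n) → K
  | none, none => 0
  | none, some _ => x₁ - x₂
  | some _, none => t * (x₁ - x₂)
  | some c, some d => if c = d then 0 else if c < d then x₁ - x₂ else t * (x₁ - x₂)

/-- The Yang–Baxter equation for a fixed boundary, after removing common factors. -/
def CoreYangBaxter (t z₁ z₂ : K) (v : Fin n → ℕ) (a b c d : Option (Fin n)) : Prop :=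
  rDiag t z₁ z₂ a b * columnCore t z₁ z₂ v a b c d +
      rOff t z₁ z₂ a b * columnCore t z₁ z₂ v b a c d =
    columnCore t z₂ z₁ v a b c d * rDiag t z₁ z₂ c d +
      columnCore t z₂ z₁ v a b d c * rOff t z₁ z₂ d c

/-- The generic pattern: each of the 24 relative orders of four distinct colors gives an identity of
rational functions in `t`, `z₁`, `z₂`. -/
theorem coreYangBaxter_of_ne {t : K} (ht : t ≠ 0) (z₁ z₂ : K) {v : Fin n → ℕ} {a b c d : Fin n}
    (hab : a ≠ b) (hcd : c ≠ d) (hac : a ≠ c) (had : a ≠ d) (hbc : b ≠ c) (hbd : b ≠ d)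
    (ha : v a = 0) (hb : v b = 0) (hc : v c = 1) (hd : v d = 1) :
    CoreYangBaxter t z₁ z₂ v (some a) (some b) (some c) (some d) := by
  simp only [CoreYangBaxter, columnCore, rDiag, rOff, coreWeight, leftFactor, rightFactor, hmult,
    Option.some.injEq, Option.elim, hab, hcd, hcd.symm, hac, had, hbc, hbd, ha, hb, hc,
    hd, if_true, if_false, false_or, and_self]
  rcases lt_or_gt_of_ne hab with h1 | h1 <;> rcases lt_or_gt_of_ne hcd with h2 | h2 <;>
  rcases lt_or_gt_of_ne hac with h3 | h3 <;> rcases lt_or_gt_of_ne had with h4 | h4 <;>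
  (try (exfalso; order)) <;>
  rcases lt_or_gt_of_ne hbc with h5 | h5 <;>
  (try (exfalso; order)) <;>
  rcases lt_or_gt_of_ne hbd with h6 | h6 <;>
  (try (exfalso; order)) <;>
  simp only [h1, h1.not_gt, h2, h2.not_gt, h3, h3.not_gt, h4, h4.not_gt, h5, h5.not_gt, h6,
    h6.not_gt, if_true, if_false] <;> field_simp <;> ring

/-- A color leaving on the right without entering on the left must come from the top; one entering
on the left without leaving on the right must end at the bottom, hence be absent from the top.
Multiplicities at most one exclude all other patterns. -/
theorem color_cases {v v' : Fin n → ℕ} (hv : ∀ e, v e ≤ 1) (hv' : ∀ e, v' e ≤ 1) {a b c d : Fin n}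
    (h : ∀ e, v' e + hmult (some c) e + hmult (some d) e =
      v e + hmult (some a) e + hmult (some b) e) :
    (b = a ∧ c = a ∧ d = a) ∨ (b = a ∧ c = a ∧ a ≠ d ∧ v a = 0 ∧ v d = 1) ∨
    (b = a ∧ d = a ∧ a ≠ c ∧ v a = 0 ∧ v c = 1) ∨ (c = a ∧ d = a ∧ a ≠ b ∧ v a = 1 ∧ v b = 0) ∨
    (c = b ∧ d = b ∧ a ≠ b ∧ v a = 0 ∧ v b = 1) ∨ (c = a ∧ d = b ∧ a ≠ b) ∨
    (d = a ∧ c = b ∧ a ≠ b) ∨ (c = a ∧ a ≠ b ∧ a ≠ d ∧ b ≠ d ∧ v b = 0 ∧ v d = 1) ∨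
    (d = a ∧ a ≠ b ∧ a ≠ c ∧ b ≠ c ∧ v b = 0 ∧ v c = 1) ∨
    (c = b ∧ a ≠ b ∧ a ≠ d ∧ b ≠ d ∧ v a = 0 ∧ v d = 1) ∨
    (d = b ∧ a ≠ b ∧ a ≠ c ∧ b ≠ c ∧ v a = 0 ∧ v c = 1) ∨
    (a ≠ b ∧ c ≠ d ∧ a ≠ c ∧ a ≠ d ∧ b ≠ c ∧ b ≠ d ∧ v a = 0 ∧ v b = 0 ∧ v c = 1 ∧ v d = 1) := by
  have ha := h a
  have hb := h b
  have hc := h c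
  have hd := h d
  have ha1 := hv a
  have hb1 := hv b
  have hc1 := hv' c
  have hd1 := hv' d
  have ha1' := hv' a
  have hb1' := hv' b
  have hc1' := hv c
  have hd1' := hv d
  clear h hv hv'
  simp only [hmult, Option.some.injEq, if_true] at ha hb hc hd
  rcases eq_or_ne b a with rfl | h1
  · rcases eq_or_ne c b with rfl | h2
    · rcases eq_or_ne d c with rfl | h3
      · simp
      · simp [h3, h3.symm] at *; omega
    · rcases eq_or_ne d b with rfl | h3
      · simp [h2, h2.symm] at *; omega
      · simp [h2, h3] at *; omega
  · rcases eq_or_ne c a with rfl | h2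
    · rcases eq_or_ne d c with rfl | h3
      · simp [h1, h1.symm] at *; omega
      · rcases eq_or_ne d b with rfl | h4
        · simp [h1.symm]
        · simp [h1, h1.symm, h3, h3.symm, h4, h4.symm] at *; omega
    · rcases eq_or_ne d a with rfl | h3
      · rcases eq_or_ne c b with rfl | h4
        · simp [h1.symm]
        · simp [h1, h1.symm, h2, h2.symm, h4, h4.symm] at *; omega
      · rcases eq_or_ne c b with rfl | h4
        · rcases eq_or_ne d c with rfl | h5
          · simp [h1, h1.symm] at *; omega
          · simp [h1, h1.symm, h3, h3.symm, h5, h5.symm] at *; omega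
        · rcases eq_or_ne d b with rfl | h5
          · simp [h1, h1.symm, h2, h2.symm, h4, h4.symm] at *; omega
          · rcases eq_or_ne c d with rfl | h6
            · simp [h2.symm, h4.symm] at *; omega
            · simp [h1, h1.symm, h2, h2.symm, h3, h3.symm, h4, h4.symm, h5, h5.symm, h6,
                h6.symm] at *; omega

theorem ne_cases {a b : Fin n} (h : a ≠ b) :
    (a < b ∧ ¬ b < a ∧ b ≠ a) ∨ (b < a ∧ ¬ a < b ∧ b ≠ a) := by
  grind

-- In each pattern, fixing the order of the colors and the multiplicities still free determines
-- every branch of the weights, and a rational identity remains.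
set_option maxHeartbeats 4000000 in
theorem coreYangBaxter_colors {t : K} (ht : t ≠ 0) (z₁ z₂ : K) {v v' : Fin n → ℕ}
    (hv : ∀ e, v e ≤ 1) (hv' : ∀ e, v' e ≤ 1) {a b c d : Fin n}
    (h : ∀ e, v' e + hmult (some c) e + hmult (some d) e =
      v e + hmult (some a) e + hmult (some b) e) :
    CoreYangBaxter t z₁ z₂ v (some a) (some b) (some c) (some d) := by
  have hva : v a = 0 ∨ v a = 1 := by have := hv a; omega
  have hvb : v b = 0 ∨ v b = 1 := by have := hv b; omega
  rcases color_cases hv hv' h with ⟨rfl, rfl, rfl⟩ | ⟨rfl, rfl, h1, h2, h3⟩ |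
    ⟨rfl, rfl, h1, h2, h3⟩ | ⟨rfl, rfl, h1, h2, h3⟩ | ⟨rfl, rfl, h1, h2, h3⟩ | ⟨rfl, rfl, h1⟩ |
    ⟨rfl, rfl, h1⟩ | ⟨rfl, h1, h2, h3, h4, h5⟩ | ⟨rfl, h1, h2, h3, h4, h5⟩ |
    ⟨rfl, h1, h2, h3, h4, h5⟩ | ⟨rfl, h1, h2, h3, h4, h5⟩ |
    ⟨h1, h2, h3, h4, h5, h6, h7, h8, h9, h10⟩ <;>
    clear h hv hv' <;>
    [rcases hva with h | h;
      (rcases ne_cases h1 with ⟨h4, h5, h6⟩ | ⟨h4, h5, h6⟩);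
      (rcases ne_cases h1 with ⟨h4, h5, h6⟩ | ⟨h4, h5, h6⟩);
      (rcases ne_cases h1 with ⟨h4, h5, h6⟩ | ⟨h4, h5, h6⟩);
      (rcases ne_cases h1 with ⟨h4, h5, h6⟩ | ⟨h4, h5, h6⟩);
      (rcases ne_cases h1 with ⟨h4, h5, h6⟩ | ⟨h4, h5, h6⟩ <;> rcases hva with h | h <;>
        rcases hvb with h' | h');
      (rcases ne_cases h1 with ⟨h4, h5, h6⟩ | ⟨h4, h5, h6⟩ <;> rcases hva with h | h <;>
        rcases hvb with h' | h');
      (rcases ne_cases h1 with ⟨h6, h7, h8⟩ | ⟨h6, h7, h8⟩ <;>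
        rcases ne_cases h2 with ⟨h9, h10, h11⟩ | ⟨h9, h10, h11⟩ <;>
        rcases ne_cases h3 with ⟨h12, h13, h14⟩ | ⟨h12, h13, h14⟩ <;>
        (first | (exfalso; order) | skip) <;>
        rcases hva with h | h <;> rcases hvb with h' | h' <;> first | (exfalso; omega) | skip);
      (rcases ne_cases h1 with ⟨h6, h7, h8⟩ | ⟨h6, h7, h8⟩ <;>
        rcases ne_cases h2 with ⟨h9, h10, h11⟩ | ⟨h9, h10, h11⟩ <;>
        rcases ne_cases h3 with ⟨h12, h13, h14⟩ | ⟨h12, h13, h14⟩ <;>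
        (first | (exfalso; order) | skip) <;>
        rcases hva with h | h <;> rcases hvb with h' | h' <;> first | (exfalso; omega) | skip);
      (rcases ne_cases h1 with ⟨h6, h7, h8⟩ | ⟨h6, h7, h8⟩ <;>
        rcases ne_cases h2 with ⟨h9, h10, h11⟩ | ⟨h9, h10, h11⟩ <;>
        rcases ne_cases h3 with ⟨h12, h13, h14⟩ | ⟨h12, h13, h14⟩ <;>
        (first | (exfalso; order) | skip) <;>
        rcases hva with h | h <;> rcases hvb with h' | h' <;> first | (exfalso; omega) | skip);
      (rcases ne_cases h1 with ⟨h6, h7, h8⟩ | ⟨h6, h7, h8⟩ <;>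
        rcases ne_cases h2 with ⟨h9, h10, h11⟩ | ⟨h9, h10, h11⟩ <;>
        rcases ne_cases h3 with ⟨h12, h13, h14⟩ | ⟨h12, h13, h14⟩ <;>
        (first | (exfalso; order) | skip) <;>
        rcases hva with h | h <;> rcases hvb with h' | h' <;> first | (exfalso; omega) | skip);
      exact coreYangBaxter_of_ne ht z₁ z₂ h1 h2 h3 h4 h5 h6 h7 h8 h9 h10]
  all_goals
    simp only [CoreYangBaxter, columnCore, rDiag, rOff, coreWeight, leftFactor, rightFactor, hmult,
      Option.some.injEq, Option.elim, reduceCtorEq, if_true, if_false, lt_irrefl, false_or, or_false,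
      true_or, or_true, true_and, and_true, false_and, and_false, and_self, or_self, zero_ne_one,
      one_ne_zero, mul_zero, zero_mul, add_zero, zero_add, Nat.sub_zero, Nat.add_sub_cancel,
      Nat.sub_self, pow_zero, pow_one, inv_one, mul_one, one_mul, *]
    field_simp
    try ring

/-! ### Boundaries with at least one uncolored horizontal edge. -/

theorem hmult_none (e : Fin n) : hmult none e = 0 := rfl

theorem color_cases_one_one {v v' : Fin n → ℕ} (hv : ∀ e, v e ≤ 1) (hv' : ∀ e, v' e ≤ 1)
    {p r : Fin n} (h : ∀ e, v' e + hmult (some r) e = v e + hmult (some p) e) :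
    r = p ∨ p ≠ r ∧ v p = 0 ∧ v r = 1 := by
  have hp := h p
  have hr := h r
  have hp1 := hv p
  have hr1 := hv r
  have hp2 := hv' p
  have hr2 := hv' r
  rcases eq_or_ne r p with rfl | h1
  · simp
  · simp [hmult, h1, h1.symm] at *; omega

theorem color_cases_one_two {v v' : Fin n → ℕ} (hv : ∀ e, v e ≤ 1) (hv' : ∀ e, v' e ≤ 1)
    {p c d : Fin n}
    (h : ∀ e, v' e + hmult (some c) e + hmult (some d) e = v e + hmult (some p) e) :
    (c = p ∧ d = p ∧ v p = 1) ∨ (c = p ∧ p ≠ d ∧ v d = 1) ∨ (d = p ∧ p ≠ c ∧ v c = 1) ∨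
    (p ≠ c ∧ p ≠ d ∧ c ≠ d ∧ v p = 0 ∧ v c = 1 ∧ v d = 1) := by
  have hp := h p
  have hc := h c
  have hd := h d
  have hp1 := hv p
  have hc1 := hv c
  have hd1 := hv d
  have hp2 := hv' p
  have hc2 := hv' c
  have hd2 := hv' d
  clear h hv hv'
  rcases eq_or_ne c p with rfl | h1
  · rcases eq_or_ne d c with rfl | h2
    · simp [hmult] at *; omega
    · simp [hmult, h2, h2.symm] at *; omega
  · rcases eq_or_ne d p with rfl | h2
    · simp [hmult, h1, h1.symm] at *; omega
    · rcases eq_or_ne c d with rfl | h3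
      · simp [hmult, h1, h1.symm] at *; omega
      · simp [hmult, h1, h1.symm, h2, h2.symm, h3, h3.symm] at *; omega

theorem color_cases_two_one {v v' : Fin n → ℕ} (hv : ∀ e, v e ≤ 1) (hv' : ∀ e, v' e ≤ 1)
    {a b r : Fin n}
    (h : ∀ e, v' e + hmult (some r) e = v e + hmult (some a) e + hmult (some b) e) :
    (a = r ∧ b = r ∧ v r = 0) ∨ (a = r ∧ r ≠ b ∧ v b = 0) ∨ (b = r ∧ r ≠ a ∧ v a = 0) ∨
    (r ≠ a ∧ r ≠ b ∧ a ≠ b ∧ v r = 1 ∧ v a = 0 ∧ v b = 0) := by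
  have hr := h r
  have ha := h a
  have hb := h b
  have hr1 := hv r
  have ha1 := hv a
  have hb1 := hv b
  have hr2 := hv' r
  have ha2 := hv' a
  have hb2 := hv' b
  clear h hv hv'
  rcases eq_or_ne a r with rfl | h1
  · rcases eq_or_ne b a with rfl | h2
    · simp [hmult] at *; omega
    · simp [hmult, h2, h2.symm] at *; omega
  · rcases eq_or_ne b r with rfl | h2
    · simp [hmult, h1, h1.symm] at *; omega
    · rcases eq_or_ne a b with rfl | h3
      · simp [hmult, h1, h1.symm] at *; omega
      · simp [hmult, h1, h1.symm, h2, h2.symm, h3, h3.symm] at *; omega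

theorem color_cases_zero_two {v v' : Fin n → ℕ} (hv : ∀ e, v e ≤ 1) {c d : Fin n}
    (h : ∀ e, v' e + hmult (some c) e + hmult (some d) e = v e) :
    c ≠ d ∧ v c = 1 ∧ v d = 1 := by
  have hc := h c
  have hd := h d
  have hc1 := hv c
  have hd1 := hv d
  clear h hv
  rcases eq_or_ne c d with rfl | h1
  · simp [hmult] at *; omega
  · simp [hmult, h1, h1.symm] at *; omega

theorem color_cases_two_zero {v v' : Fin n → ℕ} (hv' : ∀ e, v' e ≤ 1) {a b : Fin n}
    (h : ∀ e, v' e = v e + hmult (some a) e + hmult (some b) e) :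
    a ≠ b ∧ v a = 0 ∧ v b = 0 := by
  have hc := h a
  have hd := h b
  have hc1 := hv' a
  have hd1 := hv' b
  clear h hv'
  rcases eq_or_ne a b with rfl | h1
  · simp [hmult] at *; omega
  · simp [hmult, h1, h1.symm] at *; omega

theorem coreYangBaxter_nnnn (t z₁ z₂ : K) (v : Fin n → ℕ) :
    CoreYangBaxter t z₁ z₂ v none none none none := by
  simp [CoreYangBaxter, columnCore, rDiag, rOff, coreWeight]

theorem coreYangBaxter_nnns {t : K} (ht : t ≠ 0) (z₁ z₂ : K) {v v' : Fin n → ℕ}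
    (hv : ∀ e, v e ≤ 1) (hv' : ∀ e, v' e ≤ 1) {d : Fin n}
    (h : ∀ e, v' e + hmult none e + hmult (some d) e = v e + hmult none e + hmult none e) :
    CoreYangBaxter t z₁ z₂ v none none none (some d) := by
  have h1 : v d = 1 := by
    have := h d
    have := hv d
    simp [hmult] at *; omega
  clear h hv hv'
  all_goals
    simp only [CoreYangBaxter, columnCore, rDiag, rOff, coreWeight, leftFactor, rightFactor, hmult,
      Option.some.injEq, Option.elim, reduceCtorEq, if_true, if_false, lt_irrefl, false_or, or_false,
      true_or, or_true, true_and, and_true, false_and, and_false, and_self, or_self, zero_ne_one,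
      one_ne_zero, mul_zero, zero_mul, add_zero, zero_add, Nat.sub_zero, Nat.add_sub_cancel,
      Nat.sub_self, pow_zero, pow_one, inv_one, mul_one, one_mul, *]
    field_simp
    try ring

theorem coreYangBaxter_nnsn {t : K} (ht : t ≠ 0) (z₁ z₂ : K) {v v' : Fin n → ℕ}
    (hv : ∀ e, v e ≤ 1) (hv' : ∀ e, v' e ≤ 1) {c : Fin n}
    (h : ∀ e, v' e + hmult (some c) e + hmult none e = v e + hmult none e + hmult none e) :
    CoreYangBaxter t z₁ z₂ v none none (some c) none := by
  have h1 : v c = 1 := by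
    have := h c
    have := hv c
    simp [hmult] at *; omega
  clear h hv hv'
  all_goals
    simp only [CoreYangBaxter, columnCore, rDiag, rOff, coreWeight, leftFactor, rightFactor, hmult,
      Option.some.injEq, Option.elim, reduceCtorEq, if_true, if_false, lt_irrefl, false_or, or_false,
      true_or, or_true, true_and, and_true, false_and, and_false, and_self, or_self, zero_ne_one,
      one_ne_zero, mul_zero, zero_mul, add_zero, zero_add, Nat.sub_zero, Nat.add_sub_cancel,
      Nat.sub_self, pow_zero, pow_one, inv_one, mul_one, one_mul, *]
    field_simp
    try ring

theorem coreYangBaxter_nnss {t : K} (ht : t ≠ 0) (z₁ z₂ : K) {v v' : Fin n → ℕ}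
    (hv : ∀ e, v e ≤ 1) (hv' : ∀ e, v' e ≤ 1) {c d : Fin n}
    (h : ∀ e, v' e + hmult (some c) e + hmult (some d) e = v e + hmult none e + hmult none e) :
    CoreYangBaxter t z₁ z₂ v none none (some c) (some d) := by
  simp only [hmult_none, add_zero] at h
  obtain ⟨h1, h2, h3⟩ := color_cases_zero_two hv h
  clear h hv hv'
  rcases ne_cases h1 with ⟨h4, h5, h6⟩ | ⟨h4, h5, h6⟩
  all_goals
    simp only [CoreYangBaxter, columnCore, rDiag, rOff, coreWeight, leftFactor, rightFactor, hmult,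
      Option.some.injEq, Option.elim, reduceCtorEq, if_true, if_false, lt_irrefl, false_or, or_false,
      true_or, or_true, true_and, and_true, false_and, and_false, and_self, or_self, zero_ne_one,
      one_ne_zero, mul_zero, zero_mul, add_zero, zero_add, Nat.sub_zero, Nat.add_sub_cancel,
      Nat.sub_self, pow_zero, pow_one, inv_one, mul_one, one_mul, *]
    field_simp
    try ring

theorem coreYangBaxter_nsnn {t : K} (ht : t ≠ 0) (z₁ z₂ : K) {v v' : Fin n → ℕ}
    (hv : ∀ e, v e ≤ 1) (hv' : ∀ e, v' e ≤ 1) {b : Fin n}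
    (h : ∀ e, v' e + hmult none e + hmult none e = v e + hmult none e + hmult (some b) e) :
    CoreYangBaxter t z₁ z₂ v none (some b) none none := by
  have h1 : v b = 0 := by
    have := h b
    have := hv' b
    simp [hmult] at *; omega
  clear h hv hv'
  all_goals
    simp only [CoreYangBaxter, columnCore, rDiag, rOff, coreWeight, leftFactor, rightFactor, hmult,
      Option.some.injEq, Option.elim, reduceCtorEq, if_true, if_false, lt_irrefl, false_or, or_false,
      true_or, or_true, true_and, and_true, false_and, and_false, and_self, or_self, zero_ne_one,
      one_ne_zero, mul_zero, zero_mul, add_zero, zero_add, Nat.sub_zero, Nat.add_sub_cancel,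
      Nat.sub_self, pow_zero, pow_one, inv_one, mul_one, one_mul, *]
    field_simp
    try ring

theorem coreYangBaxter_snnn {t : K} (ht : t ≠ 0) (z₁ z₂ : K) {v v' : Fin n → ℕ}
    (hv : ∀ e, v e ≤ 1) (hv' : ∀ e, v' e ≤ 1) {a : Fin n}
    (h : ∀ e, v' e + hmult none e + hmult none e = v e + hmult (some a) e + hmult none e) :
    CoreYangBaxter t z₁ z₂ v (some a) none none none := by
  have h1 : v a = 0 := by
    have := h a
    have := hv' a
    simp [hmult] at *; omega
  clear h hv hv'
  all_goals
    simp only [CoreYangBaxter, columnCore, rDiag, rOff, coreWeight, leftFactor, rightFactor, hmult,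
      Option.some.injEq, Option.elim, reduceCtorEq, if_true, if_false, lt_irrefl, false_or, or_false,
      true_or, or_true, true_and, and_true, false_and, and_false, and_self, or_self, zero_ne_one,
      one_ne_zero, mul_zero, zero_mul, add_zero, zero_add, Nat.sub_zero, Nat.add_sub_cancel,
      Nat.sub_self, pow_zero, pow_one, inv_one, mul_one, one_mul, *]
    field_simp
    try ring

theorem coreYangBaxter_nsns {t : K} (ht : t ≠ 0) (z₁ z₂ : K) {v v' : Fin n → ℕ}
    (hv : ∀ e, v e ≤ 1) (hv' : ∀ e, v' e ≤ 1) {b d : Fin n}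
    (h : ∀ e, v' e + hmult none e + hmult (some d) e = v e + hmult none e + hmult (some b) e) :
    CoreYangBaxter t z₁ z₂ v none (some b) none (some d) := by
  simp only [hmult_none, add_zero] at h
  have h0 : v b = 0 ∨ v b = 1 := by have := hv b; omega
  obtain rfl | ⟨h1, h2, h3⟩ := color_cases_one_one hv hv'
      (by simpa [hmult_none] using h) <;>
    clear h hv hv' <;>
    [rcases h0 with h0 | h0; rcases ne_cases h1 with ⟨h4, h5, h6⟩ | ⟨h4, h5, h6⟩]
  all_goals
    simp only [CoreYangBaxter, columnCore, rDiag, rOff, coreWeight, leftFactor, rightFactor, hmult,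
      Option.some.injEq, Option.elim, reduceCtorEq, if_true, if_false, lt_irrefl, false_or, or_false,
      true_or, or_true, true_and, and_true, false_and, and_false, and_self, or_self, zero_ne_one,
      one_ne_zero, mul_zero, zero_mul, add_zero, zero_add, Nat.sub_zero, Nat.add_sub_cancel,
      Nat.sub_self, pow_zero, pow_one, inv_one, mul_one, one_mul, *]
    field_simp
    try ring

theorem coreYangBaxter_nssn {t : K} (ht : t ≠ 0) (z₁ z₂ : K) {v v' : Fin n → ℕ}
    (hv : ∀ e, v e ≤ 1) (hv' : ∀ e, v' e ≤ 1) {b c : Fin n}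
    (h : ∀ e, v' e + hmult (some c) e + hmult none e = v e + hmult none e + hmult (some b) e) :
    CoreYangBaxter t z₁ z₂ v none (some b) (some c) none := by
  simp only [hmult_none, add_zero] at h
  have h0 : v b = 0 ∨ v b = 1 := by have := hv b; omega
  obtain rfl | ⟨h1, h2, h3⟩ := color_cases_one_one hv hv'
      (by simpa [hmult_none] using h) <;>
    clear h hv hv' <;>
    [rcases h0 with h0 | h0; rcases ne_cases h1 with ⟨h4, h5, h6⟩ | ⟨h4, h5, h6⟩]
  all_goals
    simp only [CoreYangBaxter, columnCore, rDiag, rOff, coreWeight, leftFactor, rightFactor, hmult,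
      Option.some.injEq, Option.elim, reduceCtorEq, if_true, if_false, lt_irrefl, false_or, or_false,
      true_or, or_true, true_and, and_true, false_and, and_false, and_self, or_self, zero_ne_one,
      one_ne_zero, mul_zero, zero_mul, add_zero, zero_add, Nat.sub_zero, Nat.add_sub_cancel,
      Nat.sub_self, pow_zero, pow_one, inv_one, mul_one, one_mul, *]
    field_simp
    try ring

theorem coreYangBaxter_snns {t : K} (ht : t ≠ 0) (z₁ z₂ : K) {v v' : Fin n → ℕ}
    (hv : ∀ e, v e ≤ 1) (hv' : ∀ e, v' e ≤ 1) {a d : Fin n}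
    (h : ∀ e, v' e + hmult none e + hmult (some d) e = v e + hmult (some a) e + hmult none e) :
    CoreYangBaxter t z₁ z₂ v (some a) none none (some d) := by
  simp only [hmult_none, add_zero] at h
  have h0 : v a = 0 ∨ v a = 1 := by have := hv a; omega
  obtain rfl | ⟨h1, h2, h3⟩ := color_cases_one_one hv hv'
      (by simpa [hmult_none] using h) <;>
    clear h hv hv' <;>
    [rcases h0 with h0 | h0; rcases ne_cases h1 with ⟨h4, h5, h6⟩ | ⟨h4, h5, h6⟩]
  all_goals
    simp only [CoreYangBaxter, columnCore, rDiag, rOff, coreWeight, leftFactor, rightFactor, hmult,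
      Option.some.injEq, Option.elim, reduceCtorEq, if_true, if_false, lt_irrefl, false_or, or_false,
      true_or, or_true, true_and, and_true, false_and, and_false, and_self, or_self, zero_ne_one,
      one_ne_zero, mul_zero, zero_mul, add_zero, zero_add, Nat.sub_zero, Nat.add_sub_cancel,
      Nat.sub_self, pow_zero, pow_one, inv_one, mul_one, one_mul, *]
    field_simp
    try ring

theorem coreYangBaxter_snsn {t : K} (ht : t ≠ 0) (z₁ z₂ : K) {v v' : Fin n → ℕ}
    (hv : ∀ e, v e ≤ 1) (hv' : ∀ e, v' e ≤ 1) {a c : Fin n}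
    (h : ∀ e, v' e + hmult (some c) e + hmult none e = v e + hmult (some a) e + hmult none e) :
    CoreYangBaxter t z₁ z₂ v (some a) none (some c) none := by
  simp only [hmult_none, add_zero] at h
  have h0 : v a = 0 ∨ v a = 1 := by have := hv a; omega
  obtain rfl | ⟨h1, h2, h3⟩ := color_cases_one_one hv hv'
      (by simpa [hmult_none] using h) <;>
    clear h hv hv' <;>
    [rcases h0 with h0 | h0; rcases ne_cases h1 with ⟨h4, h5, h6⟩ | ⟨h4, h5, h6⟩]
  all_goals
    simp only [CoreYangBaxter, columnCore, rDiag, rOff, coreWeight, leftFactor, rightFactor, hmult,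
      Option.some.injEq, Option.elim, reduceCtorEq, if_true, if_false, lt_irrefl, false_or, or_false,
      true_or, or_true, true_and, and_true, false_and, and_false, and_self, or_self, zero_ne_one,
      one_ne_zero, mul_zero, zero_mul, add_zero, zero_add, Nat.sub_zero, Nat.add_sub_cancel,
      Nat.sub_self, pow_zero, pow_one, inv_one, mul_one, one_mul, *]
    field_simp
    try ring

theorem coreYangBaxter_nsss {t : K} (ht : t ≠ 0) (z₁ z₂ : K) {v v' : Fin n → ℕ}
    (hv : ∀ e, v e ≤ 1) (hv' : ∀ e, v' e ≤ 1) {b c d : Fin n}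
    (h : ∀ e, v' e + hmult (some c) e + hmult (some d) e = v e + hmult none e + hmult (some b) e) :
    CoreYangBaxter t z₁ z₂ v none (some b) (some c) (some d) := by
  simp only [hmult_none, add_zero] at h
  have h0 : v b = 0 ∨ v b = 1 := by have := hv b; omega
  obtain ⟨rfl, rfl, h1⟩ | ⟨rfl, h1, h2⟩ | ⟨rfl, h1, h2⟩ | ⟨h1, h2, h3, h4, h5, h6⟩ :=
    color_cases_one_two hv hv' (by simpa [hmult_none] using h) <;>
    clear h hv hv' <;>
    [skip;
      (rcases ne_cases h1 with ⟨h4, h5, h6⟩ | ⟨h4, h5, h6⟩ <;> rcases h0 with h0 | h0);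
      (rcases ne_cases h1 with ⟨h4, h5, h6⟩ | ⟨h4, h5, h6⟩ <;> rcases h0 with h0 | h0);
      (rcases ne_cases h1 with ⟨h7, h8, h9⟩ | ⟨h7, h8, h9⟩ <;>
        rcases ne_cases h2 with ⟨h10, h11, h12⟩ | ⟨h10, h11, h12⟩ <;>
        rcases ne_cases h3 with ⟨h13, h14, h15⟩ | ⟨h13, h14, h15⟩ <;>
        first | (exfalso; order) | skip)]
  all_goals
    simp only [CoreYangBaxter, columnCore, rDiag, rOff, coreWeight, leftFactor, rightFactor, hmult,
      Option.some.injEq, Option.elim, reduceCtorEq, if_true, if_false, lt_irrefl, false_or, or_false,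
      true_or, or_true, true_and, and_true, false_and, and_false, and_self, or_self, zero_ne_one,
      one_ne_zero, mul_zero, zero_mul, add_zero, zero_add, Nat.sub_zero, Nat.add_sub_cancel,
      Nat.sub_self, pow_zero, pow_one, inv_one, mul_one, one_mul, *]
    field_simp
    try ring

theorem coreYangBaxter_snss {t : K} (ht : t ≠ 0) (z₁ z₂ : K) {v v' : Fin n → ℕ}
    (hv : ∀ e, v e ≤ 1) (hv' : ∀ e, v' e ≤ 1) {a c d : Fin n}
    (h : ∀ e, v' e + hmult (some c) e + hmult (some d) e = v e + hmult (some a) e + hmult none e) :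
    CoreYangBaxter t z₁ z₂ v (some a) none (some c) (some d) := by
  simp only [hmult_none, add_zero] at h
  have h0 : v a = 0 ∨ v a = 1 := by have := hv a; omega
  obtain ⟨rfl, rfl, h1⟩ | ⟨rfl, h1, h2⟩ | ⟨rfl, h1, h2⟩ | ⟨h1, h2, h3, h4, h5, h6⟩ :=
    color_cases_one_two hv hv' (by simpa [hmult_none] using h) <;>
    clear h hv hv' <;>
    [skip;
      (rcases ne_cases h1 with ⟨h4, h5, h6⟩ | ⟨h4, h5, h6⟩ <;> rcases h0 with h0 | h0);
      (rcases ne_cases h1 with ⟨h4, h5, h6⟩ | ⟨h4, h5, h6⟩ <;> rcases h0 with h0 | h0);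
      (rcases ne_cases h1 with ⟨h7, h8, h9⟩ | ⟨h7, h8, h9⟩ <;>
        rcases ne_cases h2 with ⟨h10, h11, h12⟩ | ⟨h10, h11, h12⟩ <;>
        rcases ne_cases h3 with ⟨h13, h14, h15⟩ | ⟨h13, h14, h15⟩ <;>
        first | (exfalso; order) | skip)]
  all_goals
    simp only [CoreYangBaxter, columnCore, rDiag, rOff, coreWeight, leftFactor, rightFactor, hmult,
      Option.some.injEq, Option.elim, reduceCtorEq, if_true, if_false, lt_irrefl, false_or, or_false,
      true_or, or_true, true_and, and_true, false_and, and_false, and_self, or_self, zero_ne_one,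
      one_ne_zero, mul_zero, zero_mul, add_zero, zero_add, Nat.sub_zero, Nat.add_sub_cancel,
      Nat.sub_self, pow_zero, pow_one, inv_one, mul_one, one_mul, *]
    field_simp
    try ring

theorem coreYangBaxter_ssns {t : K} (ht : t ≠ 0) (z₁ z₂ : K) {v v' : Fin n → ℕ}
    (hv : ∀ e, v e ≤ 1) (hv' : ∀ e, v' e ≤ 1) {a b d : Fin n}
    (h : ∀ e, v' e + hmult none e + hmult (some d) e = v e + hmult (some a) e + hmult (some b) e) :
    CoreYangBaxter t z₁ z₂ v (some a) (some b) none (some d) := by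
  simp only [hmult_none, add_zero] at h
  have h0 : v d = 0 ∨ v d = 1 := by have := hv d; omega
  obtain ⟨rfl, rfl, h1⟩ | ⟨rfl, h1, h2⟩ | ⟨rfl, h1, h2⟩ | ⟨h1, h2, h3, h4, h5, h6⟩ :=
    color_cases_two_one hv hv' (by simpa [hmult_none] using h) <;>
    clear h hv hv' <;>
    [skip;
      (rcases ne_cases h1 with ⟨h4, h5, h6⟩ | ⟨h4, h5, h6⟩ <;> rcases h0 with h0 | h0);
      (rcases ne_cases h1 with ⟨h4, h5, h6⟩ | ⟨h4, h5, h6⟩ <;> rcases h0 with h0 | h0);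
      (rcases ne_cases h1 with ⟨h7, h8, h9⟩ | ⟨h7, h8, h9⟩ <;>
        rcases ne_cases h2 with ⟨h10, h11, h12⟩ | ⟨h10, h11, h12⟩ <;>
        rcases ne_cases h3 with ⟨h13, h14, h15⟩ | ⟨h13, h14, h15⟩ <;>
        first | (exfalso; order) | skip)]
  all_goals
    simp only [CoreYangBaxter, columnCore, rDiag, rOff, coreWeight, leftFactor, rightFactor, hmult,
      Option.some.injEq, Option.elim, reduceCtorEq, if_true, if_false, lt_irrefl, false_or, or_false,
      true_or, or_true, true_and, and_true, false_and, and_false, and_self, or_self, zero_ne_one,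
      one_ne_zero, mul_zero, zero_mul, add_zero, zero_add, Nat.sub_zero, Nat.add_sub_cancel,
      Nat.sub_self, pow_zero, pow_one, inv_one, mul_one, one_mul, *]
    field_simp
    try ring

theorem coreYangBaxter_sssn {t : K} (ht : t ≠ 0) (z₁ z₂ : K) {v v' : Fin n → ℕ}
    (hv : ∀ e, v e ≤ 1) (hv' : ∀ e, v' e ≤ 1) {a b c : Fin n}
    (h : ∀ e, v' e + hmult (some c) e + hmult none e = v e + hmult (some a) e + hmult (some b) e) :
    CoreYangBaxter t z₁ z₂ v (some a) (some b) (some c) none := by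
  simp only [hmult_none, add_zero] at h
  have h0 : v c = 0 ∨ v c = 1 := by have := hv c; omega
  obtain ⟨rfl, rfl, h1⟩ | ⟨rfl, h1, h2⟩ | ⟨rfl, h1, h2⟩ | ⟨h1, h2, h3, h4, h5, h6⟩ :=
    color_cases_two_one hv hv' (by simpa [hmult_none] using h) <;>
    clear h hv hv' <;>
    [skip;
      (rcases ne_cases h1 with ⟨h4, h5, h6⟩ | ⟨h4, h5, h6⟩ <;> rcases h0 with h0 | h0);
      (rcases ne_cases h1 with ⟨h4, h5, h6⟩ | ⟨h4, h5, h6⟩ <;> rcases h0 with h0 | h0);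
      (rcases ne_cases h1 with ⟨h7, h8, h9⟩ | ⟨h7, h8, h9⟩ <;>
        rcases ne_cases h2 with ⟨h10, h11, h12⟩ | ⟨h10, h11, h12⟩ <;>
        rcases ne_cases h3 with ⟨h13, h14, h15⟩ | ⟨h13, h14, h15⟩ <;>
        first | (exfalso; order) | skip)]
  all_goals
    simp only [CoreYangBaxter, columnCore, rDiag, rOff, coreWeight, leftFactor, rightFactor, hmult,
      Option.some.injEq, Option.elim, reduceCtorEq, if_true, if_false, lt_irrefl, false_or, or_false,
      true_or, or_true, true_and, and_true, false_and, and_false, and_self, or_self, zero_ne_one,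
      one_ne_zero, mul_zero, zero_mul, add_zero, zero_add, Nat.sub_zero, Nat.add_sub_cancel,
      Nat.sub_self, pow_zero, pow_one, inv_one, mul_one, one_mul, *]
    field_simp
    try ring

theorem coreYangBaxter_ssnn {t : K} (ht : t ≠ 0) (z₁ z₂ : K) {v v' : Fin n → ℕ}
    (hv : ∀ e, v e ≤ 1) (hv' : ∀ e, v' e ≤ 1) {a b : Fin n}
    (h : ∀ e, v' e + hmult none e + hmult none e = v e + hmult (some a) e + hmult (some b) e) :
    CoreYangBaxter t z₁ z₂ v (some a) (some b) none none := by
  simp only [hmult_none, add_zero] at h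
  obtain ⟨h1, h2, h3⟩ := color_cases_two_zero hv' h
  clear h hv hv'
  rcases ne_cases h1 with ⟨h4, h5, h6⟩ | ⟨h4, h5, h6⟩
  all_goals
    simp only [CoreYangBaxter, columnCore, rDiag, rOff, coreWeight, leftFactor, rightFactor, hmult,
      Option.some.injEq, Option.elim, reduceCtorEq, if_true, if_false, lt_irrefl, false_or, or_false,
      true_or, or_true, true_and, and_true, false_and, and_false, and_self, or_self, zero_ne_one,
      one_ne_zero, mul_zero, zero_mul, add_zero, zero_add, Nat.sub_zero, Nat.add_sub_cancel,
      Nat.sub_self, pow_zero, pow_one, inv_one, mul_one, one_mul, *]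
    field_simp
    try ring

theorem coreYangBaxter {t : K} (ht : t ≠ 0) (z₁ z₂ : K) {v v' : Fin n → ℕ}
    (hv : ∀ e, v e ≤ 1) (hv' : ∀ e, v' e ≤ 1) (a b c d : Option (Fin n))
    (h : ∀ e, v' e + hmult c e + hmult d e = v e + hmult a e + hmult b e) :
    CoreYangBaxter t z₁ z₂ v a b c d := by
  rcases a with _ | a <;> rcases b with _ | b <;> rcases c with _ | c <;> rcases d with _ | d
  · exact coreYangBaxter_nnnn t z₁ z₂ v
  · exact coreYangBaxter_nnns ht z₁ z₂ hv hv' h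
  · exact coreYangBaxter_nnsn ht z₁ z₂ hv hv' h
  · exact coreYangBaxter_nnss ht z₁ z₂ hv hv' h
  · exact coreYangBaxter_nsnn ht z₁ z₂ hv hv' h
  · exact coreYangBaxter_nsns ht z₁ z₂ hv hv' h
  · exact coreYangBaxter_nssn ht z₁ z₂ hv hv' h
  · exact coreYangBaxter_nsss ht z₁ z₂ hv hv' h
  · exact coreYangBaxter_snnn ht z₁ z₂ hv hv' h
  · exact coreYangBaxter_snns ht z₁ z₂ hv hv' h
  · exact coreYangBaxter_snsn ht z₁ z₂ hv hv' h
  · exact coreYangBaxter_snss ht z₁ z₂ hv hv' h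
  · exact coreYangBaxter_ssnn ht z₁ z₂ hv hv' h
  · exact coreYangBaxter_ssns ht z₁ z₂ hv hv' h
  · exact coreYangBaxter_sssn ht z₁ z₂ hv hv' h
  · exact coreYangBaxter_colors ht z₁ z₂ hv hv' h

/-! ### The Yang–Baxter equation for columns, in matrix form. -/

theorem Conserved₂.swap_left {p q c d : Option (Fin n)} {S B : Finset (Fin n)}
    (h : Conserved₂ p q S c d B) : Conserved₂ q p S c d B := by
  intro e; have := h e; omega

theorem Conserved₂.swap_right {p q c d : Option (Fin n)} {S B : Finset (Fin n)}
    (h : Conserved₂ p q S c d B) : Conserved₂ p q S d c B := by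
  intro e; have := h e; omega

/-- The entries of `R` are homogeneous of degree one, so the column parameter drops out of the
equation and the same `R` serves every column. -/
theorem rDiag_div (t x₁ x₂ y : K) (a b : Option (Fin n)) :
    rDiag t (x₁ / y) (x₂ / y) a b = rDiag t x₁ x₂ a b / y := by
  unfold rDiag; split <;> [skip; skip; skip; split_ifs] <;> ring

theorem rOff_div (t x₁ x₂ y : K) (a b : Option (Fin n)) :
    rOff t (x₁ / y) (x₂ / y) a b = rOff t x₁ x₂ a b / y := by
  unfold rOff; split <;> [skip; skip; skip; split_ifs] <;> ring

/-- The Yang–Baxter equation for a column. -/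
theorem columnWeight_yangBaxter {t : K} (ht : t ≠ 0) (x₁ x₂ : K) {y : K} (hy : y ≠ 0)
    (S B : Finset (Fin n)) (a b c d : Option (Fin n)) :
    rDiag t x₁ x₂ a b * columnWeight t x₁ x₂ y S B (a, b) (c, d) +
        rOff t x₁ x₂ a b * columnWeight t x₁ x₂ y S B (b, a) (c, d) =
      columnWeight t x₂ x₁ y S B (a, b) (c, d) * rDiag t x₁ x₂ c d +
        columnWeight t x₂ x₁ y S B (a, b) (d, c) * rOff t x₁ x₂ d c := by
  by_cases h : Conserved₂ a b S c d B
  · have hS : ∀ U : Finset (Fin n), ∀ e, vmult U e ≤ 1 := by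
      intro U e; unfold vmult; split_ifs <;> simp
    have key := coreYangBaxter ht (x₁ / y) (x₂ / y) (hS S) (hS B) a b c d h
    simp only [CoreYangBaxter, rDiag_div, rOff_div] at key
    rw [columnWeight_eq ht _ _ _ h, columnWeight_eq ht _ _ _ h.swap_left,
      columnWeight_eq ht _ _ _ h, columnWeight_eq ht _ _ _ h.swap_right]
    field_simp at key
    linear_combination ((∏ e ∈ S, leftFactor t a e) * (∏ e ∈ S, leftFactor t b e) *
        ((∏ e ∈ S, rightFactor c e) * ∏ e ∈ S, rightFactor d e)) * key
  · rw [columnWeight_eq_zero ht _ _ _ h,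
      columnWeight_eq_zero ht _ _ _ fun h' => h h'.swap_left,
      columnWeight_eq_zero ht _ _ _ h,
      columnWeight_eq_zero ht _ _ _ fun h' => h h'.swap_right]
    simp

/-- The `R`-matrix. -/
def rMatrix (t x₁ x₂ : K) :
    Matrix (Option (Fin n) × Option (Fin n)) (Option (Fin n) × Option (Fin n)) K :=
  fun p q => (if q = p then rDiag t x₁ x₂ p.1 p.2 else 0) +
    if q = p.swap then rOff t x₁ x₂ p.1 p.2 else 0

theorem rMatrix_mul_apply (t x₁ x₂ : K)
    (D : Matrix (Option (Fin n) × Option (Fin n)) (Option (Fin n) × Option (Fin n)) K)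
    (p q : Option (Fin n) × Option (Fin n)) :
    (rMatrix (n := n) t x₁ x₂ * D) p q =
      rDiag t x₁ x₂ p.1 p.2 * D p q + rOff t x₁ x₂ p.1 p.2 * D p.swap q := by
  simp [Matrix.mul_apply, rMatrix, add_mul, Finset.sum_add_distrib]

theorem mul_rMatrix_apply (t x₁ x₂ : K)
    (D : Matrix (Option (Fin n) × Option (Fin n)) (Option (Fin n) × Option (Fin n)) K)
    (p q : Option (Fin n) × Option (Fin n)) :
    (D * rMatrix (n := n) t x₁ x₂) p q =
      D p q * rDiag t x₁ x₂ q.1 q.2 + D p q.swap * rOff t x₁ x₂ q.2 q.1 := by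
  have h (x : Option (Fin n) × Option (Fin n)) : q = x.swap ↔ x = q.swap := by
    constructor <;> rintro rfl <;> simp
  simp [Matrix.mul_apply, rMatrix, mul_add, Finset.sum_add_distrib, h]

theorem rMatrix_mul_columnWeight {t : K} (ht : t ≠ 0) (x₁ x₂ : K) {y : K} (hy : y ≠ 0)
    (S B : Finset (Fin n)) :
    rMatrix t x₁ x₂ * Matrix.of (columnWeight t x₁ x₂ y S B) =
      Matrix.of (columnWeight t x₂ x₁ y S B) * rMatrix t x₁ x₂ := by
  ext p q
  rw [rMatrix_mul_apply, mul_rMatrix_apply]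
  exact columnWeight_yangBaxter ht x₁ x₂ hy S B p.1 p.2 q.1 q.2

end YangBaxter

/-! ### Transfer matrices of rows and the exchange relation. -/

section Rows

variable {K : Type*} [Field K] {n : ℕ}

theorem sum_fin_succ_pi {α : Type*} [Fintype α] {k : ℕ} (f : (Fin (k + 1) → α) → K) :
    ∑ v, f v = ∑ a, ∑ v : Fin k → α, f (Fin.cons a v) := by
  rw [← Fintype.sum_prod_type', ← (Fin.consEquiv fun _ => α).sum_comp]
  rfl

/-- A product of matrices as a sum over paths. -/
theorem list_ofFn_prod_apply {V : Type*} [Fintype V] [DecidableEq V] {k : ℕ}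
    (A : Fin k → Matrix V V K) (a b : V) :
    (List.ofFn A).prod a b = ∑ v : Fin (k + 1) → V,
      if v 0 = a ∧ v (Fin.last k) = b then ∏ i, A i (v i.castSucc) (v i.succ) else 0 := by
  induction k generalizing a with
  | zero =>
    rw [sum_fin_succ_pi]
    simp [Matrix.one_apply, ite_and]
  | succ k ih =>
    rw [List.ofFn_succ, List.prod_cons, Matrix.mul_apply, sum_fin_succ_pi]
    symm
    rw [Finset.sum_eq_single a]
    · simp only [ih, Finset.mul_sum]
      rw [Finset.sum_comm]
      refine Finset.sum_congr rfl fun v _ => ?_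
      rw [Finset.sum_eq_single (v 0)]
      · simp only [Fin.cons_zero, ← Fin.succ_last, Fin.cons_succ, mul_ite,
          mul_zero, Fin.prod_univ_succ, Fin.castSucc_zero, Fin.castSucc_succ, true_and]
      · intro m _ hm
        rw [if_neg fun h => hm h.1.symm, mul_zero]
      · simp
    · intro m _ hm
      simp [hm]
    · simp

theorem sum_sum_sum_sum_comm {α β γ δ : Type*} [Fintype α] [Fintype β] [Fintype γ] [Fintype δ]
    (F : α → β → γ → δ → K) :
    ∑ a, ∑ b, ∑ c, ∑ d, F a b c d = ∑ c, ∑ d, ∑ b, ∑ a, F a b c d := by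
  have h : ∑ p : α × β, ∑ q : γ × δ, F p.1 p.2 q.1 q.2 =
      ∑ q : γ × δ, ∑ p : α × β, F p.1 p.2 q.1 q.2 := Finset.sum_comm
  simp only [Fintype.sum_prod_type] at h
  rw [h]
  exact Finset.sum_congr rfl fun c _ => Finset.sum_congr rfl fun d _ => Finset.sum_comm

/-- The weights of a column vertex as a matrix from the right to the left edge. -/
def vertexMatrix (t x y : K) (S B : Finset (Fin n)) :
    Matrix (Option (Fin n)) (Option (Fin n)) K :=
  Matrix.of fun r l => weight t x y l S r B

/-- The weight of a row with given boundary, summed over its inner horizontal edges. -/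
def rowWeight {N : ℕ} (t x : K) (y : Fin N → K) (l r : Option (Fin n))
    (S B : Fin N → Finset (Fin n)) : K :=
  (List.ofFn fun j => vertexMatrix t x (y j) (S j) (B j)).prod r l

theorem rowWeight_zero (t x : K) (y : Fin 0 → K) (l r : Option (Fin n))
    (S B : Fin 0 → Finset (Fin n)) : rowWeight t x y l r S B = if r = l then 1 else 0 := by
  simp [rowWeight, Matrix.one_apply]

theorem rowWeight_succ {N : ℕ} (t x : K) (y : Fin (N + 1) → K) (l r : Option (Fin n))
    (S B : Fin (N + 1) → Finset (Fin n)) : rowWeight t x y l r S B =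
      ∑ m, rowWeight t x (Fin.tail y) l m (Fin.tail S) (Fin.tail B) *
        weight t x (y 0) m (S 0) r (B 0) := by
  rw [rowWeight, List.ofFn_succ, List.prod_cons, Matrix.mul_apply]
  exact Finset.sum_congr rfl fun m _ => mul_comm _ _

/-- The weight of two adjacent rows, the upper one with parameter `x₁`, summed over the vertical
edges between them. -/
def twoRowWeight {N : ℕ} (t x₁ x₂ : K) (y : Fin N → K) (S B : Fin N → Finset (Fin n)) :
    Matrix (Option (Fin n) × Option (Fin n)) (Option (Fin n) × Option (Fin n)) K :=
  Matrix.of fun l r => ∑ m, rowWeight t x₁ y l.1 r.1 S m * rowWeight t x₂ y l.2 r.2 m B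

theorem twoRowWeight_zero (t x₁ x₂ : K) (y : Fin 0 → K) (S B : Fin 0 → Finset (Fin n)) :
    twoRowWeight t x₁ x₂ y S B = 1 := by
  ext l r
  have h : l = r ↔ r.2 = l.2 ∧ r.1 = l.1 := by
    rw [Prod.ext_iff, and_comm, eq_comm, eq_comm (a := l.1)]
  simp [twoRowWeight, rowWeight_zero, Matrix.one_apply, h, ite_and]

/-- The sum over the edges between the rows splits off the rightmost column. Matrices here run from
left to right, so that column is the last factor. -/
theorem twoRowWeight_succ {N : ℕ} (t x₁ x₂ : K) (y : Fin (N + 1) → K)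
    (S B : Fin (N + 1) → Finset (Fin n)) :
    twoRowWeight t x₁ x₂ y S B =
      twoRowWeight t x₁ x₂ (Fin.tail y) (Fin.tail S) (Fin.tail B) *
        Matrix.of (columnWeight t x₁ x₂ (y 0) (S 0) (B 0)) := by
  ext l r
  rw [Matrix.mul_apply]
  simp only [twoRowWeight, Matrix.of_apply, columnWeight]
  rw [sum_fin_succ_pi]
  simp only [rowWeight_succ, Fin.tail_cons, Fin.cons_zero, Finset.sum_mul_sum,
    Fintype.sum_prod_type]
  rw [sum_sum_sum_sum_comm]
  refine Finset.sum_congr rfl fun e _ => Finset.sum_congr rfl fun f _ =>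
    Finset.sum_congr rfl fun m' _ => Finset.sum_congr rfl fun m _ => by ring

/-- The train argument: `R` is pushed from the left boundary to the right, one column at a time. -/
theorem rMatrix_mul_twoRowWeight {t : K} (ht : t ≠ 0) (x₁ x₂ : K) {N : ℕ} (y : Fin N → K)
    (hy : ∀ j, y j ≠ 0) (S B : Fin N → Finset (Fin n)) :
    rMatrix t x₁ x₂ * twoRowWeight t x₁ x₂ y S B =
      twoRowWeight t x₂ x₁ y S B * rMatrix t x₁ x₂ := by
  induction N with
  | zero => simp [twoRowWeight_zero]
  | succ N ih =>
    rw [twoRowWeight_succ, ← mul_assoc, ih (Fin.tail y) fun j => hy j.succ, mul_assoc,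
      rMatrix_mul_columnWeight ht _ _ (hy 0), ← mul_assoc, ← twoRowWeight_succ]

/-- The transfer matrix of a row with uncolored left edge and right edge `c`. -/
def rowMatrix {N : ℕ} (t x : K) (y : Fin N → K) (c : Fin n) :
    Matrix (Fin N → Finset (Fin n)) (Fin N → Finset (Fin n)) K :=
  Matrix.of fun S B => rowWeight t x y none (some c) S B

theorem rowMatrix_exchange {t : K} (ht : t ≠ 0) (x₁ x₂ : K) {N : ℕ} (y : Fin N → K)
    (hy : ∀ j, y j ≠ 0) {c d : Fin n} (hcd : c < d) :
    (x₂ - t * x₁) • (rowMatrix t x₁ y d * rowMatrix t x₂ y c) =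
      ((1 - t) * x₁) • (rowMatrix t x₂ y d * rowMatrix t x₁ y c) +
        (x₁ - x₂) • (rowMatrix t x₂ y c * rowMatrix t x₁ y d) := by
  ext S B
  -- With both left edges uncolored, `R` acts there as the scalar `x₂ - t * x₁`; on the right, the
  -- larger color in the upper row selects the two remaining coefficients.
  have h := congrFun (congrFun (rMatrix_mul_twoRowWeight ht x₁ x₂ y hy S B) (none, none))
    (some d, some c)
  rw [rMatrix_mul_apply, mul_rMatrix_apply] at h
  simp only [rDiag, rOff, Prod.swap, twoRowWeight, Matrix.of_apply, hcd.ne, hcd.ne', hcd,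
    hcd.not_gt, if_true, if_false] at h
  simp only [Matrix.smul_apply, Matrix.add_apply, Matrix.mul_apply, rowMatrix, Matrix.of_apply,
    smul_eq_mul]
  linear_combination h

end Rows

/-! ### The partition function as a matrix product, and its behavior under `s_i`. -/

section PartitionFunction

variable {K : Type*} [Field K] {n : ℕ}

/-- The labels of the top edges. -/
def topLabels (N : ℕ) (σ : Equiv.Perm (Fin n)) (lam : Fin n → ℕ) (j : Fin N) : Finset (Fin n) :=
  (Finset.univ.filter (fun i : Fin n => lam i = (j : ℕ) + 1)).image (fun i => σ i.rev)

theorem rowWeight_eq_sum {N : ℕ} (t x : K) (y : Fin N → K) (l r : Option (Fin n))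
    (S B : Fin N → Finset (Fin n)) : rowWeight t x y l r S B =
      ∑ h : Fin (N + 1) → Option (Fin n), if h 0 = r ∧ h (Fin.last N) = l then
        ∏ j, weight t x (y j) (h j.succ) (S j) (h j.castSucc) (B j) else 0 :=
  list_ofFn_prod_apply _ _ _

/-- For fixed vertical edges the horizontal sums separate by rows; the sum over vertical edges is
then matrix multiplication from top to bottom. -/
theorem partitionFunction_eq_prod {N : ℕ} (t : K) (lam : Fin n → ℕ)
    (σ w : Equiv.Perm (Fin n)) (x : Fin n → K) (y : Fin N → K) :
    partitionFunction t lam σ w x y =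
      (List.ofFn fun i => rowMatrix t (x i) y (w i)).prod (topLabels N σ lam) fun _ => ∅ := by
  rw [list_ofFn_prod_apply, partitionFunction, Finset.sum_filter,
    ← (Decoration.equivProd n N).symm.sum_comp, Fintype.sum_prod_type, Finset.sum_comm]
  refine Finset.sum_congr rfl fun v _ => ?_
  simp only [rowMatrix, Matrix.of_apply, rowWeight_eq_sum]
  rw [Finset.prod_univ_sum, Fintype.piFinset_univ]
  split_ifs with hv
  · refine Finset.sum_congr rfl fun h _ => ?_
    rw [Finset.prod_ite_zero]
    have hv1 := congrFun hv.1
    have hv2 := congrFun hv.2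
    by_cases hh : ∀ i ∈ Finset.univ, h i 0 = some (w i) ∧ h i (Fin.last N) = none
    · rw [if_pos hh, if_pos]
      · rfl
      · exact ⟨hv1, fun i => (hh i (Finset.mem_univ i)).1, fun i => (hh i (Finset.mem_univ i)).2,
          hv2⟩
    · rw [if_neg hh, if_neg]
      exact fun ⟨_, h2, h3, _⟩ => hh fun i _ => ⟨h2 i, h3 i⟩
  · refine Finset.sum_eq_zero fun h _ => if_neg ?_
    rintro ⟨h1, -, -, h4⟩
    exact hv ⟨funext h1, funext h4⟩

/-- `P` and `Q` are chosen before `A'`, so one pair serves all three terms of the exchange relation,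
which differ only in two adjacent rows. -/
theorem exists_list_ofFn_prod_eq {M : Type*} [Monoid M] {k i : ℕ} (hi : i + 1 < k)
    (A : Fin k → M) : ∃ P Q : M, ∀ A' : Fin k → M, (∀ j : Fin k, (j : ℕ) ≠ i → (j : ℕ) ≠ i + 1 →
      A' j = A j) → (List.ofFn A').prod =
        P * (A' ⟨i, Nat.lt_of_succ_lt hi⟩ * A' ⟨i + 1, hi⟩) * Q := by
  induction k generalizing i with
  | zero => omega
  | succ k ih =>
    rcases i with _ | i
    · rcases k with _ | k
      · omega
      refine ⟨1, (List.ofFn fun j : Fin k => A j.succ.succ).prod, fun A' h => ?_⟩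
      have h' : (fun j : Fin k => A' j.succ.succ) = fun j => A j.succ.succ := by
        funext j
        exact h _ (by simp) (by simp)
      rw [List.ofFn_succ, List.ofFn_succ, List.prod_cons, List.prod_cons, h', one_mul, mul_assoc]
      rfl
    · obtain ⟨P, Q, h⟩ := ih (Nat.lt_of_succ_lt_succ hi) fun j => A j.succ
      refine ⟨A 0 * P, Q, fun A' h' => ?_⟩
      rw [List.ofFn_succ, List.prod_cons, h fun j => A' j.succ, h' 0 (by simp) (by simp)]
      · simp only [mul_assoc]; rfl
      · intro j h1 h2
        exact h' _ (by simpa using h1) (by simpa using h2)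

theorem squareZ_exchange {t : K} (ht : t ≠ 0) (σ w : Equiv.Perm (Fin n)) (x : Fin n → K)
    {y : Fin n → K} (hy : ∀ j, y j ≠ 0) (i : ℕ) (hi : i + 1 < n)
    (hw : w ⟨i + 1, hi⟩ < w ⟨i, Nat.lt_of_succ_lt hi⟩) :
    (x ⟨i, Nat.lt_of_succ_lt hi⟩ - t * x ⟨i + 1, hi⟩) *
        squareZ t σ w (fun k => x (simpleRefl i hi k)) y =
      (1 - t) * x ⟨i + 1, hi⟩ * squareZ t σ w x y +
        (x ⟨i + 1, hi⟩ - x ⟨i, Nat.lt_of_succ_lt hi⟩) * squareZ t σ (w * simpleRefl i hi) x y := by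
  simp only [squareZ, partitionFunction_eq_prod]
  obtain ⟨P, Q, h⟩ := exists_list_ofFn_prod_eq hi fun k => rowMatrix t (x k) y (w k)
  have hs1 : simpleRefl i hi ⟨i, Nat.lt_of_succ_lt hi⟩ = ⟨i + 1, hi⟩ := Equiv.swap_apply_left _ _
  have hs2 : simpleRefl i hi ⟨i + 1, hi⟩ = ⟨i, Nat.lt_of_succ_lt hi⟩ := Equiv.swap_apply_right _ _
  have hs3 : ∀ j : Fin n, (j : ℕ) ≠ i → (j : ℕ) ≠ i + 1 → simpleRefl i hi j = j := fun j h1 h2 =>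
    Equiv.swap_apply_of_ne_of_ne (fun h => h1 (congrArg Fin.val h)) fun h => h2 (congrArg Fin.val h)
  rw [h (fun k => rowMatrix t (x k) y (w k)) fun _ _ _ => rfl,
    h (fun k => rowMatrix t (x (simpleRefl i hi k)) y (w k)) fun j h1 h2 => by
      simp only [hs3 j h1 h2],
    h (fun k => rowMatrix t (x k) y ((w * simpleRefl i hi) k)) fun j h1 h2 => by
      simp only [Equiv.Perm.mul_apply, hs3 j h1 h2]]
  simp only [Equiv.Perm.mul_apply, hs1, hs2]
  -- The parameters enter in swapped order, so the term with scalar coefficient is the one whose row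
  -- variables are permuted by `s_i`.
  have key := rowMatrix_exchange ht (x ⟨i + 1, hi⟩) (x ⟨i, Nat.lt_of_succ_lt hi⟩) y hy hw
  have key' := congrArg (fun X => (P * X * Q) (topLabels n σ (staircase n)) fun _ => ∅) key
  simpa only [mul_add, add_mul, Matrix.mul_smul, Matrix.smul_mul, Matrix.add_apply,
    Matrix.smul_apply, smul_eq_mul] using key'

/-! ### The frozen model at the longest permutation. -/

theorem weight_none_empty (t x y : K) (r : Option (Fin n)) (B : Finset (Fin n)) :
    weight t x y none ∅ r B = if r = none ∧ B = ∅ then 1 else 0 := by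
  rcases r with _ | c <;> simp [weight]

theorem rowWeight_none_empty {N : ℕ} (t x : K) (y : Fin N → K) (r : Option (Fin n))
    (B : Fin N → Finset (Fin n)) :
    rowWeight t x y none r (fun _ => ∅) B = if r = none ∧ B = fun _ => ∅ then 1 else 0 := by
  induction N generalizing r with
  | zero => rw [rowWeight_zero]; simp [funext_iff]
  | succ N ih =>
    rw [rowWeight_succ, Finset.sum_eq_single none]
    · have h : Fin.tail (fun _ : Fin (N + 1) => (∅ : Finset (Fin n))) = fun _ => ∅ := rfl
      rw [h, ih, weight_none_empty]
      simp only [funext_iff, Fin.forall_fin_succ (P := fun j => B j = ∅), Fin.tail]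
      split_ifs <;> simp_all
    · intro m _ hm
      have h : Fin.tail (fun _ : Fin (N + 1) => (∅ : Finset (Fin n))) = fun _ => ∅ := rfl
      rw [h, ih, if_neg (by simp [hm]), zero_mul]
    · simp

/-- A color leaving on the right and absent from the top must come straight from the left. No larger
color crosses it, so the powers of `t` are trivial. -/
theorem weight_some_of_notMem (t x y : K) (l : Option (Fin n)) {S : Finset (Fin n)} {c : Fin n}
    (hc : c ∉ S) (hS : ∀ e ∈ S, e ≤ c) (B : Finset (Fin n)) :
    weight t x y l S (some c) B = if l = some c ∧ B = S then 1 - x / y else 0 := by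
  rcases l with _ | d
  · simp [weight, hc]
  · by_cases hd : d = c
    · subst hd
      have h1 : S.filter (fun e => d < e) = ∅ := by
        ext e; simpa using fun he => hS e he
      have h2 : S.filter (fun e => e = d) = ∅ := by
        ext e; simp; rintro he rfl; exact hc he
      simp [weight, h1, h2]
    · simp [weight, hd, hc]

/-- Left of column `p` nothing enters the row. At `p` the color `c` turns right with weight `1`, and
it then crosses every column to the right of `p`, each contributing `1 - x / y j`. -/
theorem rowWeight_pivot {N : ℕ} (t x : K) (y : Fin N → K) {c : Fin n} {p : Fin N}
    {S : Fin N → Finset (Fin n)} (hp : S p = {c}) (hgt : ∀ j, p < j → S j = ∅)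
    (hlt : ∀ j, j < p → c ∉ S j ∧ ∀ e ∈ S j, e ≤ c) (B : Fin N → Finset (Fin n)) :
    rowWeight t x y none (some c) S B =
      if B = Function.update S p ∅ then ∏ j ∈ Finset.univ.filter (fun j => j < p), (1 - x / y j)
      else 0 := by
  induction N with
  | zero => exact p.elim0
  | succ N ih =>
    rw [rowWeight_succ]
    refine Fin.cases (fun hp hgt hlt => ?_) (fun p hp hgt hlt => ?_) p hp hgt hlt
    · have hS : Fin.tail S = fun _ => ∅ := funext fun j => hgt _ (Fin.succ_pos j)
      rw [Finset.sum_eq_single none]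
      · rw [hS, rowWeight_none_empty]
        have : (B = Function.update S 0 ∅) ↔ B 0 = ∅ ∧ Fin.tail B = fun _ => ∅ := by
          simp only [funext_iff, Fin.forall_fin_succ (P := fun j => B j = _), Fin.tail]
          have h' := fun j => congrFun hS j
          simp only [Fin.tail] at h'
          simp [h', Function.update]
        simp only [this, hp]
        simp only [weight]
        have hc : ({c} : Finset (Fin n)).erase c = ∅ := by simp
        simp only [hc, Finset.filter_singleton]
        split_ifs <;> simp_all
      · intro m _ hm
        rw [hS, rowWeight_none_empty, if_neg (by simp [hm]), zero_mul]
      · simp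
    · have h0 := hlt 0 (Fin.succ_pos p)
      rw [Finset.sum_eq_single (some c)]
      · rw [ih (p := p) (Fin.tail y) (S := Fin.tail S) hp (fun j hj => hgt j.succ (by simpa using hj))
          fun j hj => hlt j.succ (by simpa using hj), weight_some_of_notMem _ _ _ _ h0.1 h0.2]
        have : (B = Function.update S p.succ ∅) ↔
            B 0 = S 0 ∧ Fin.tail B = Function.update (Fin.tail S) p ∅ := by
          simp only [funext_iff, Fin.forall_fin_succ (P := fun j => B j = _), Fin.tail]
          simp [Function.update, Fin.ext_iff, Fin.tail]
        rw [if_congr this rfl rfl]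
        have hprod : ∏ j ∈ Finset.univ.filter (fun j => j < p.succ), (1 - x / y j) =
            (1 - x / y 0) *
              ∏ j ∈ Finset.univ.filter (fun j => j < p), (1 - x / Fin.tail y j) := by
          rw [Finset.prod_filter, Finset.prod_filter, Fin.prod_univ_succ]
          simp [Fin.tail]
        rw [hprod]
        split_ifs <;> simp_all [mul_comm]
      · intro m _ hm
        rw [weight_some_of_notMem _ _ _ _ h0.1 h0.2, if_neg (by simp [hm]), mul_zero]
      · simp

/-- If each matrix has only one nonzero entry available in the row reached so far, a single path
survives in the product. -/
theorem list_ofFn_prod_of_eq_ite {V : Type*} [Fintype V] [DecidableEq V] {k : ℕ}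
    (A : Fin k → Matrix V V K) (S : Fin (k + 1) → V) (a : Fin k → K)
    (h : ∀ i b, A i (S i.castSucc) b = if b = S i.succ then a i else 0) (b : V) :
    (List.ofFn A).prod (S 0) b = if b = S (Fin.last k) then ∏ i, a i else 0 := by
  induction k with
  | zero => simp [Matrix.one_apply, eq_comm]
  | succ k ih =>
    rw [List.ofFn_succ, List.prod_cons, Matrix.mul_apply, Finset.sum_eq_single (S (Fin.succ 0))]
    · rw [ih (fun i => A i.succ) (fun i => S i.succ) (fun i => a i.succ) fun i b => h i.succ b,
        Fin.prod_univ_succ]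
      have := h 0 (S (Fin.succ 0))
      rw [if_pos rfl] at this
      simp only [Fin.castSucc_zero] at this
      rw [this, Fin.succ_last]
      simp
    · intro v _ hv
      have := h 0 v
      rw [if_neg hv, Fin.castSucc_zero] at this
      rw [this, zero_mul]
    · simp

theorem squareZ_longest (t : K) (x y : Fin n → K) :
    squareZ t 1 (longest n) x y =
      ∏ i : Fin n, ∏ j ∈ Finset.univ.filter (fun j : Fin n => (i : ℕ) + (j : ℕ) + 2 ≤ n),
        (1 - x i / y j) := by
  rw [squareZ, partitionFunction_eq_prod]
  -- The vertical edges of the unique state: each row removes the largest remaining color, which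
  -- sits in the leftmost nonempty column.
  let S : Fin (n + 1) → Fin n → Finset (Fin n) := fun k j => if (j : ℕ) + k < n then {j} else ∅
  have hS0 : topLabels n 1 (staircase n) = S 0 := by
    funext j
    ext e
    simp only [topLabels, S, Finset.mem_image, Finset.mem_filter_univ, Equiv.Perm.one_apply,
      Fin.val_zero, add_zero, j.isLt, if_true, Finset.mem_singleton]
    constructor
    · rintro ⟨i, hi, rfl⟩
      unfold staircase at hi
      ext
      rw [Fin.val_rev]
      omega
    · rintro rfl
      exact ⟨e.rev, by unfold staircase; rw [Fin.val_rev]; omega, Fin.rev_rev e⟩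
  have hSl : (fun _ => ∅) = S (Fin.last n) := by
    funext j; simp [S]
  rw [hS0, hSl, list_ofFn_prod_of_eq_ite _ S _ ?_, if_pos rfl]
  intro i B
  rw [rowMatrix, Matrix.of_apply, rowWeight_pivot t (x i) y (p := longest n i)]
  · have h1 : Function.update (S i.castSucc) (longest n i) ∅ = S i.succ := by
      funext j
      by_cases hj : j = longest n i
      · subst hj
        simp [S, longest]
      · rw [Function.update_of_ne hj]
        have : (j : ℕ) ≠ n - (i + 1) := fun h => hj (Fin.ext (by simp [longest, h]))
        simp only [S, Fin.val_castSucc, Fin.val_succ]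
        refine if_ctx_congr (by omega) (fun _ => rfl) fun _ => rfl
    rw [h1]
    have h2 : ∀ j : Fin n, j < longest n i ↔ (i : ℕ) + (j : ℕ) + 2 ≤ n := by
      intro j
      simp [longest, Fin.lt_def]; omega
    simp only [h2]
  · simp [S, longest, Fin.revPerm]; omega
  · intro j hj
    simp [S, longest, Fin.lt_def] at hj ⊢; omega
  · intro j hj
    have hj' : (j : ℕ) + i < n := by simp [longest, Fin.lt_def] at hj; omega
    simp only [S, Fin.val_castSucc, hj', if_true, Finset.mem_singleton, forall_eq]
    exact ⟨hj.ne', hj.le⟩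

end PartitionFunction

/-! ### Length, descents and the longest element. -/

section Length

variable {n : ℕ}

theorem simpleRefl_mul_self (i : ℕ) (hi : i + 1 < n) : simpleRefl i hi * simpleRefl i hi = 1 :=
  Equiv.swap_mul_self _ _

theorem simpleRefl_simpleRefl (i : ℕ) (hi : i + 1 < n) (k : Fin n) :
    simpleRefl i hi (simpleRefl i hi k) = k :=
  Equiv.swap_apply_self _ _ _

theorem simpleRefl_left (i : ℕ) (hi : i + 1 < n) :
    simpleRefl i hi ⟨i, Nat.lt_of_succ_lt hi⟩ = ⟨i + 1, hi⟩ := Equiv.swap_apply_left _ _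

theorem simpleRefl_right (i : ℕ) (hi : i + 1 < n) :
    simpleRefl i hi ⟨i + 1, hi⟩ = ⟨i, Nat.lt_of_succ_lt hi⟩ := Equiv.swap_apply_right _ _

theorem val_simpleRefl (i : ℕ) (hi : i + 1 < n) (k : Fin n) :
    (simpleRefl i hi k : ℕ) = if (k : ℕ) = i then i + 1 else if (k : ℕ) = i + 1 then i else k := by
  simp only [simpleRefl, Equiv.swap_apply_def, Fin.ext_iff]
  split_ifs <;> rfl

theorem simpleRefl_lt_simpleRefl {i : ℕ} {hi : i + 1 < n} {a b : Fin n} (hab : a < b)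
    (h : ¬ ((a : ℕ) = i ∧ (b : ℕ) = i + 1)) : simpleRefl i hi a < simpleRefl i hi b := by
  rw [Fin.lt_def] at *
  rw [val_simpleRefl, val_simpleRefl]
  split_ifs <;> omega

/-- The simple transposition preserves the order of every pair of positions except `(i, i + 1)`. The
inversions of `w s_i` are therefore the relabeled inversions of `w` together with this one pair. -/
theorem len_mul_simpleRefl {w : Equiv.Perm (Fin n)} {i : ℕ} (hi : i + 1 < n)
    (hw : w ⟨i, Nat.lt_of_succ_lt hi⟩ < w ⟨i + 1, hi⟩) :
    len (w * simpleRefl i hi) = len w + 1 := by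
  set s := simpleRefl i hi with hs
  have h : Finset.univ.filter (fun p : Fin n × Fin n => p.1 < p.2 ∧ (w * s) p.2 < (w * s) p.1) =
      insert (⟨i, Nat.lt_of_succ_lt hi⟩, ⟨i + 1, hi⟩)
        ((Finset.univ.filter (fun p : Fin n × Fin n => p.1 < p.2 ∧ w p.2 < w p.1)).map
          (s.prodCongr s).toEmbedding) := by
    ext ⟨a, b⟩
    simp only [Finset.mem_filter_univ, Finset.mem_insert, Finset.mem_map_equiv]
    have hsymm : (s.prodCongr s).symm (a, b) = (s a, s b) := by
      simp [hs, simpleRefl]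
    rw [hsymm]
    constructor
    · rintro ⟨h1, h2⟩
      by_cases h3 : (a : ℕ) = i ∧ (b : ℕ) = i + 1
      · exact Or.inl (Prod.ext (Fin.ext h3.1) (Fin.ext h3.2))
      · exact Or.inr ⟨simpleRefl_lt_simpleRefl h1 h3, h2⟩
    · rintro (h1 | ⟨h1, h2⟩)
      · obtain ⟨rfl, rfl⟩ := Prod.mk.inj h1
        rw [Equiv.Perm.mul_apply, Equiv.Perm.mul_apply, simpleRefl_left, simpleRefl_right]
        exact ⟨Nat.lt_succ_self i, hw⟩
      · refine ⟨?_, h2⟩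
        have := simpleRefl_lt_simpleRefl (hi := hi) h1 fun h3 => by
          have e1 : s a = ⟨i, Nat.lt_of_succ_lt hi⟩ := Fin.ext h3.1
          have e2 : s b = ⟨i + 1, hi⟩ := Fin.ext h3.2
          rw [e1, e2] at h2
          exact h2.not_gt hw
        rwa [simpleRefl_simpleRefl, simpleRefl_simpleRefl] at this
  rw [len, h, Finset.card_insert_of_notMem, Finset.card_map]
  · rfl
  · rw [Finset.mem_map_equiv]
    have hsymm : (s.prodCongr s).symm (⟨i, Nat.lt_of_succ_lt hi⟩, ⟨i + 1, hi⟩) =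
        (⟨i + 1, hi⟩, ⟨i, Nat.lt_of_succ_lt hi⟩) := by
      rw [Equiv.symm_apply_eq]
      exact Prod.ext (simpleRefl_right i hi).symm (simpleRefl_left i hi).symm
    rw [hsymm, Finset.mem_filter_univ]
    exact fun h' => h'.1.not_gt (Nat.lt_succ_self i)

theorem len_mul_simpleRefl_add_one {w : Equiv.Perm (Fin n)} {i : ℕ} (hi : i + 1 < n)
    (hw : w ⟨i + 1, hi⟩ < w ⟨i, Nat.lt_of_succ_lt hi⟩) :
    len (w * simpleRefl i hi) + 1 = len w := by
  rw [← len_mul_simpleRefl hi, mul_assoc, simpleRefl_mul_self, mul_one]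
  rwa [Equiv.Perm.mul_apply, Equiv.Perm.mul_apply, simpleRefl_left, simpleRefl_right]

theorem lt_or_gt_apply (w : Equiv.Perm (Fin n)) {i : ℕ} (hi : i + 1 < n) :
    w ⟨i, Nat.lt_of_succ_lt hi⟩ < w ⟨i + 1, hi⟩ ∨ w ⟨i + 1, hi⟩ < w ⟨i, Nat.lt_of_succ_lt hi⟩ :=
  lt_or_gt_of_ne fun h => by simpa using w.injective h

theorem len_lt_len_mul_simpleRefl_iff {w : Equiv.Perm (Fin n)} {i : ℕ} (hi : i + 1 < n) :
    len w < len (w * simpleRefl i hi) ↔ w ⟨i, Nat.lt_of_succ_lt hi⟩ < w ⟨i + 1, hi⟩ := by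
  rcases lt_or_gt_apply w hi with h | h
  · simp [h, len_mul_simpleRefl hi h]
  · have := len_mul_simpleRefl_add_one hi h
    simp only [h.not_gt, iff_false]
    omega

theorem len_mul_simpleRefl_lt_len_iff {w : Equiv.Perm (Fin n)} {i : ℕ} (hi : i + 1 < n) :
    len (w * simpleRefl i hi) < len w ↔ w ⟨i + 1, hi⟩ < w ⟨i, Nat.lt_of_succ_lt hi⟩ := by
  rcases lt_or_gt_apply w hi with h | h
  · simp [h.not_gt, len_mul_simpleRefl hi h]
  · have := len_mul_simpleRefl_add_one hi h
    simp only [h, iff_true]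
    omega

theorem len_inv (w : Equiv.Perm (Fin n)) : len w⁻¹ = len w := by
  refine Finset.card_nbij' (fun p => (w⁻¹ p.2, w⁻¹ p.1)) (fun p => (w p.2, w p.1)) ?_ ?_ ?_ ?_
  · rintro ⟨a, b⟩; simp; tauto
  · rintro ⟨a, b⟩; simp; tauto
  · rintro ⟨a, b⟩; simp
  · rintro ⟨a, b⟩; simp

theorem len_one : len (1 : Equiv.Perm (Fin n)) = 0 := by
  rw [len, Finset.card_eq_zero, Finset.filter_eq_empty_iff]
  rintro ⟨a, b⟩ _ ⟨h1, h2⟩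
  exact h1.not_gt h2

theorem exists_descent {w : Equiv.Perm (Fin n)} (hw : w ≠ 1) :
    ∃ (i : ℕ) (hi : i + 1 < n), w ⟨i + 1, hi⟩ < w ⟨i, Nat.lt_of_succ_lt hi⟩ := by
  by_contra! h
  refine hw ?_
  have hmono : StrictMono w := by
    rcases n with _ | n
    · exact fun a => a.elim0
    · refine Fin.strictMono_iff_lt_succ.2 fun i => ?_
      exact (h i (by simp)).lt_of_ne fun h' => by simpa [Fin.ext_iff] using w.injective h'
  -- A permutation without descents is an order automorphism of a finite chain, and the identity is
  -- the only one.
  have := Subsingleton.elim (hmono.orderIsoOfSurjective w w.surjective) (OrderIso.refl (Fin n))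
  ext k
  have := congrArg (fun e : Fin n ≃o Fin n => e k) this
  simpa using congrArg Fin.val this

theorem longest_lt_longest {a b : Fin n} : longest n a < longest n b ↔ b < a := Fin.rev_lt_rev

theorem longest_longest (a : Fin n) : longest n (longest n a) = a := Fin.rev_rev a

theorem longest_mul_longest : longest n * longest n = 1 := Equiv.ext longest_longest

theorem exists_ascent {w : Equiv.Perm (Fin n)} (hw : w ≠ longest n) :
    ∃ (i : ℕ) (hi : i + 1 < n), w ⟨i, Nat.lt_of_succ_lt hi⟩ < w ⟨i + 1, hi⟩ := by
  have h : longest n * w ≠ 1 := fun h => hw <| by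
    rw [← one_mul w, ← longest_mul_longest, mul_assoc, h, mul_one]
  obtain ⟨i, hi, h'⟩ := exists_descent h
  exact ⟨i, hi, longest_lt_longest.1 h'⟩

/-- The two permutations are mutually inverse because `w₀` is an involution. This form makes right
multiplication of `w` by `s_i` visible. -/
theorem len_inv_mul_longest (w : Equiv.Perm (Fin n)) :
    len (w⁻¹ * longest n) = len (longest n * w) := by
  rw [← len_inv (longest n * w), mul_inv_rev]
  congr 2

end Length

/-! ### Rational functions, the operators `T_i^∨`, and existence and uniqueness of the classes. -/

section Classes

variable {n : ℕ}

theorem var_ne_zero (v : Var n) : var v ≠ 0 := by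
  rw [var, Ne, FaithfulSMul.algebraMap_eq_zero_iff]
  exact MvPolynomial.X_ne_zero v

theorem var_injective : Function.Injective (var (n := n)) := fun _ _ h =>
  MvPolynomial.X_injective (IsFractionRing.injective _ _ h)

theorem tVar_ne_zero : tVar n ≠ 0 := var_ne_zero _

theorem xVar_ne_zero (i : Fin n) : xVar n i ≠ 0 := var_ne_zero _

theorem yVar_ne_zero (j : Fin n) : yVar n j ≠ 0 := var_ne_zero _

theorem xVar_injective : Function.Injective (xVar n) := fun i j h => by
  simpa using var_injective h

theorem actX_var (e : Equiv.Perm (Fin n)) (v : Var n) : actX e (var v) = var (Var.permX e v) := by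
  rw [actX, var, IsFractionRing.ringEquivOfRingEquiv_algebraMap]
  simp [var]

theorem actX_tVar (e : Equiv.Perm (Fin n)) : actX e (tVar n) = tVar n := actX_var _ _

theorem actX_xVar (e : Equiv.Perm (Fin n)) (i : Fin n) : actX e (xVar n i) = xVar n (e i) :=
  actX_var _ _

theorem actX_yVar (e : Equiv.Perm (Fin n)) (j : Fin n) : actX e (yVar n j) = yVar n j :=
  actX_var _ _

theorem map_weight {K L F : Type*} [Field K] [Field L] [FunLike F K L] [RingHomClass F K L] (φ : F)
    (t x y : K) (l : Option (Fin n)) (S : Finset (Fin n)) (r : Option (Fin n))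
    (B : Finset (Fin n)) : φ (weight t x y l S r B) = weight (φ t) (φ x) (φ y) l S r B := by
  rcases l with _ | c <;> rcases r with _ | d <;> simp only [weight] <;> split_ifs <;> simp

/-- Applied to the action of `s_i` on rational functions, this identifies that action with the
exchange of two row parameters. -/
theorem map_squareZ {K L F : Type*} [Field K] [Field L] [FunLike F K L] [RingHomClass F K L]
    (φ : F) (t : K) (σ w : Equiv.Perm (Fin n)) (x y : Fin n → K) :
    φ (squareZ t σ w x y) = squareZ (φ t) σ w (fun i => φ (x i)) fun j => φ (y j) := by
  simp only [squareZ, partitionFunction, Decoration.boltzmann, map_sum, map_prod, map_weight]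

/-- The weights are polynomials in `t` and `x / y`, which is why the partition functions are Laurent
polynomials. -/
theorem weight_mem {K : Type*} [Field K] (A : Subring K) {t x y : K} (ht : t ∈ A)
    (hxy : x / y ∈ A) (l : Option (Fin n)) (S : Finset (Fin n)) (r : Option (Fin n))
    (B : Finset (Fin n)) : weight t x y l S r B ∈ A := by
  have h1 : ∀ k : ℕ, (-t) ^ k ∈ A := fun k => A.pow_mem (A.neg_mem ht) k
  have h2 : ∀ k : ℕ, t ^ k ∈ A := fun k => A.pow_mem ht k
  have h3 : ∀ k : ℕ, (-1 : K) ^ k ∈ A := fun k => A.pow_mem (A.neg_mem A.one_mem) k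
  have h4 : t - 1 ∈ A := A.sub_mem ht A.one_mem
  rcases l with _ | c <;> rcases r with _ | d <;> simp only [weight] <;> split_ifs <;>
    first
    | exact A.zero_mem
    | exact h1 _
    | exact A.mul_mem (h1 _) (h2 _)
    | exact A.mul_mem (A.mul_mem h4 hxy) (h1 _)
    | exact A.mul_mem (h2 _) (A.sub_mem (h2 _) hxy)
    | exact A.mul_mem (A.mul_mem (A.mul_mem h4 hxy) (h1 _)) (h2 _)
    | exact A.mul_mem (A.mul_mem h4 (h3 _)) (h2 _)

theorem squareZ_mem {K : Type*} [Field K] (A : Subring K) {t : K} {x y : Fin n → K} (ht : t ∈ A)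
    (hxy : ∀ i j, x i / y j ∈ A) (σ w : Equiv.Perm (Fin n)) : squareZ t σ w x y ∈ A :=
  A.sum_mem fun _ _ => A.prod_mem fun _ _ => A.prod_mem fun _ _ => weight_mem A ht (hxy _ _) _ _ _ _

theorem var_mem_laurent (v : Var n) : var v ∈ laurent n :=
  Algebra.subset_adjoin ⟨v, Or.inl rfl⟩

theorem var_inv_mem_laurent (v : Var n) : (var v)⁻¹ ∈ laurent n :=
  Algebra.subset_adjoin ⟨v, Or.inr rfl⟩

theorem neg_tVar_zpow_mul_squareZ_mem_laurent (k : ℕ) (σ w e : Equiv.Perm (Fin n)) :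
    (-tVar n) ^ (-(k : ℤ)) * squareZ (tVar n) σ w (xVar n) (fun j => yVar n (e j)) ∈
      laurent n := by
  refine (laurent n).mul_mem ?_ ?_
  · have h : (-tVar n)⁻¹ = -(tVar n)⁻¹ := inv_neg
    rw [zpow_neg, zpow_natCast, ← inv_pow, h]
    exact (laurent n).pow_mem ((laurent n).neg_mem (var_inv_mem_laurent _)) k
  · refine squareZ_mem (laurent n).toSubring (var_mem_laurent _) (fun i j => ?_) σ w
    exact (div_eq_mul_inv (xVar n i) _).symm ▸
      (laurent n).mul_mem (var_mem_laurent _) (var_inv_mem_laurent _)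

/-- Solving the exchange relation for `Z''` yields the coefficients of `T_i^∨` up to the factor
`-t`; this is the origin of the normalization. -/
theorem eq_dualT_coeff {K : Type*} [Field K] {t a b Z Z' Z'' : K} (ht : t ≠ 0) (ha : a ≠ 0)
    (hb : b ≠ 0) (hab : a ≠ b)
    (h : (a - t * b) * Z' = (1 - t) * b * Z + (b - a) * Z'') :
    Z'' = -t * ((1 - t⁻¹) / (a / b - 1) * Z + (-t⁻¹ + (a / b)⁻¹) / ((a / b)⁻¹ - 1) * Z') := by
  have h1 : a - b ≠ 0 := sub_ne_zero.2 hab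
  have h2 : b - a ≠ 0 := sub_ne_zero.2 hab.symm
  have e1 : (1 - t⁻¹) / (a / b - 1) = (t - 1) * b / (t * (a - b)) := by
    rw [div_sub_one hb]; field_simp
  have e2 : (-t⁻¹ + (a / b)⁻¹) / ((a / b)⁻¹ - 1) = (a - t * b) / (t * (a - b)) := by
    rw [inv_div, div_sub_one ha]; field_simp; ring
  rw [e1, e2]
  field_simp
  linear_combination h

theorem squareZ_mul_simpleRefl (σ w e : Equiv.Perm (Fin n)) {i : ℕ} (hi : i + 1 < n)
    (hw : w ⟨i + 1, hi⟩ < w ⟨i, Nat.lt_of_succ_lt hi⟩) :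
    squareZ (tVar n) σ (w * simpleRefl i hi) (xVar n) (fun j => yVar n (e j)) =
      -tVar n * dualT i hi (squareZ (tVar n) σ w (xVar n) fun j => yVar n (e j)) := by
  have h := squareZ_exchange tVar_ne_zero σ w (xVar n) (fun j => yVar_ne_zero (e j)) i hi hw
  rw [dualT, map_squareZ]
  simp only [actX_tVar, actX_xVar, actX_yVar]
  refine eq_dualT_coeff tVar_ne_zero (xVar_ne_zero _) (xVar_ne_zero _) ?_ h
  exact fun h' => by simpa using xVar_injective h'

theorem dualT_neg_tVar_zpow_mul {i : ℕ} (hi : i + 1 < n) (k : ℤ) (f : RatFun n) :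
    dualT i hi ((-tVar n) ^ k * f) = (-tVar n) ^ k * dualT i hi f := by
  simp only [dualT, map_mul, map_zpow₀, map_neg, actX_tVar]
  ring

theorem dualT_step (σ w e : Equiv.Perm (Fin n)) {i : ℕ} (hi : i + 1 < n)
    (hw : w ⟨i + 1, hi⟩ < w ⟨i, Nat.lt_of_succ_lt hi⟩) (k : ℕ) :
    (-tVar n) ^ (-((k + 1 : ℕ) : ℤ)) *
        squareZ (tVar n) σ (w * simpleRefl i hi) (xVar n) (fun j => yVar n (e j)) =
      dualT i hi ((-tVar n) ^ (-(k : ℤ)) *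
        squareZ (tVar n) σ w (xVar n) fun j => yVar n (e j)) := by
  have ht : -tVar n ≠ 0 := neg_ne_zero.2 tVar_ne_zero
  rw [squareZ_mul_simpleRefl σ w e hi hw, dualT_neg_tVar_zpow_mul, ← mul_assoc, ← zpow_add_one₀ ht]
  congr 3
  push_cast
  ring

theorem isDualMCX_squareZ (n : ℕ) : IsDualMCX n fun w =>
    (-tVar n) ^ (-(len w : ℤ)) *
      squareZ (tVar n) 1 (longest n * w) (xVar n) (fun j => yVar n (longest n j)) where
  mem_laurent w := neg_tVar_zpow_mul_squareZ_mem_laurent _ _ _ _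
  base := by
    rw [len_one, mul_one, squareZ_longest]
    simp only [Nat.cast_zero, neg_zero, zpow_zero, one_mul]
    refine Finset.prod_congr rfl fun i _ => ?_
    -- Reversing the column parameters turns the triangle `i + j + 2 ≤ n` into `i < j`.
    rw [Finset.prod_filter, Finset.prod_filter, ← Equiv.prod_comp (longest n)]
    refine Finset.prod_congr rfl fun j _ => ?_
    rw [longest_longest]
    refine if_ctx_congr ?_ (fun _ => rfl) fun _ => rfl
    have : ((longest n j : Fin n) : ℕ) = n - (j + 1) := Fin.val_rev j
    rw [this, Fin.lt_def]
    omega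
  step w i hi h := by
    rw [len_lt_len_mul_simpleRefl_iff] at h
    rw [len_mul_simpleRefl hi h, ← mul_assoc]
    -- The ascent of `w` at `i` is a descent of `w₀w`, as the recursion for the partition function
    -- requires.
    exact dualT_step 1 (longest n * w) (longest n) hi (longest_lt_longest.2 h) (len w)

theorem isDualMCY_squareZ (n : ℕ) : IsDualMCY n fun w =>
    (-tVar n) ^ (-(len (w⁻¹ * longest n) : ℤ)) * squareZ (tVar n) 1 w (xVar n) (yVar n) where
  mem_laurent w := neg_tVar_zpow_mul_squareZ_mem_laurent _ _ _ 1
  base := by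
    rw [inv_mul_cancel, len_one, squareZ_longest]
    simp
  step w i hi h := by
    rw [len_mul_simpleRefl_lt_len_iff] at h
    rw [len_inv_mul_longest, len_inv_mul_longest, ← mul_assoc,
      len_mul_simpleRefl (w := longest n * w) hi (longest_lt_longest.2 h)]
    exact dualT_step 1 w 1 hi h _

/-- A descent `i` of `w ≠ 1` gives `w = (w s_i) s_i` with `w s_i` shorter, so the value at `w` is
forced by that at `w s_i`. -/
theorem IsDualMCX.unique {F F' : Equiv.Perm (Fin n) → RatFun n} (h : IsDualMCX n F)
    (h' : IsDualMCX n F') : F = F' := by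
  suffices ∀ k w, len w = k → F w = F' w from funext fun w => this _ w rfl
  intro k
  induction k with
  | zero =>
    intro w hw
    by_cases h1 : w = 1
    · rw [h1, h.base, h'.base]
    · obtain ⟨i, hi, hlt⟩ := exists_descent h1
      have := len_mul_simpleRefl_add_one hi hlt
      omega
  | succ k ih =>
    intro w hw
    by_cases h1 : w = 1
    · rw [h1, h.base, h'.base]
    · obtain ⟨i, hi, hlt⟩ := exists_descent h1
      have h2 := len_mul_simpleRefl_add_one hi hlt
      have h3 : w * simpleRefl i hi * simpleRefl i hi = w := by
        rw [mul_assoc, simpleRefl_mul_self, mul_one]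
      have h4 := h.step (w * simpleRefl i hi) i hi (by rw [h3]; omega)
      have h5 := h'.step (w * simpleRefl i hi) i hi (by rw [h3]; omega)
      rw [h3] at h4 h5
      rw [h4, h5, ih _ (by omega)]

/-- The induction runs downward from `w₀`, measured by the length of `w₀w`, with ascents in place of
descents. -/
theorem IsDualMCY.unique {G G' : Equiv.Perm (Fin n) → RatFun n} (h : IsDualMCY n G)
    (h' : IsDualMCY n G') : G = G' := by
  suffices ∀ k w, len (longest n * w) = k → G w = G' w from funext fun w => this _ w rfl
  intro k
  induction k with
  | zero =>
    intro w hw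
    by_cases h1 : w = longest n
    · rw [h1, h.base, h'.base]
    · obtain ⟨i, hi, hlt⟩ := exists_ascent h1
      have := len_mul_simpleRefl_add_one (w := longest n * w) hi (longest_lt_longest.2 hlt)
      omega
  | succ k ih =>
    intro w hw
    by_cases h1 : w = longest n
    · rw [h1, h.base, h'.base]
    · obtain ⟨i, hi, hlt⟩ := exists_ascent h1
      have h2 := len_mul_simpleRefl_add_one (w := longest n * w) hi (longest_lt_longest.2 hlt)
      have h3 : w * simpleRefl i hi * simpleRefl i hi = w := by
        rw [mul_assoc, simpleRefl_mul_self, mul_one]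
      have h6 := len_mul_simpleRefl hi hlt
      have h4 := h.step (w * simpleRefl i hi) i hi (by rw [h3]; omega)
      have h5 := h'.step (w * simpleRefl i hi) i hi (by rw [h3]; omega)
      rw [h3] at h4 h5
      rw [h4, h5, ih _ (by rw [← mul_assoc]; omega)]

end Classes

end MotivicLattice

theorem theorem5p3 (n : ℕ) :
    (∃! F : Equiv.Perm (Fin n) → MotivicLattice.RatFun n, MotivicLattice.IsDualMCX n F) ∧
    (∃! G : Equiv.Perm (Fin n) → MotivicLattice.RatFun n, MotivicLattice.IsDualMCY n G) ∧
    ∀ w : Equiv.Perm (Fin n),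
      MotivicLattice.dualMCX n w =
        (-MotivicLattice.tVar n) ^ (-(MotivicLattice.len w : ℤ)) *
          MotivicLattice.squareZ (MotivicLattice.tVar n) 1 (MotivicLattice.longest n * w)
            (MotivicLattice.xVar n)
            (fun j => MotivicLattice.yVar n (MotivicLattice.longest n j)) ∧
      MotivicLattice.dualMCY n w =
        (-MotivicLattice.tVar n) ^
            (-(MotivicLattice.len (w⁻¹ * MotivicLattice.longest n) : ℤ)) *
          MotivicLattice.squareZ (MotivicLattice.tVar n) 1 w
            (MotivicLattice.xVar n) (MotivicLattice.yVar n) := by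
  have hX := MotivicLattice.isDualMCX_squareZ n
  have hY := MotivicLattice.isDualMCY_squareZ n
  -- The classes are defined by choice, so they have the defining properties only because the
  -- partition functions show that such a family exists.
  have hX' : MotivicLattice.IsDualMCX n (MotivicLattice.dualMCX n) :=
    Classical.epsilon_spec ⟨_, hX⟩
  have hY' : MotivicLattice.IsDualMCY n (MotivicLattice.dualMCY n) :=
    Classical.epsilon_spec ⟨_, hY⟩
  exact ⟨⟨_, hX, fun F hF => hF.unique hX⟩, ⟨_, hY, fun G hG => hG.unique hY⟩,
    fun w => ⟨congrFun (hX'.unique hX) w, congrFun (hY'.unique hY) w⟩⟩
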